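/- Consider a chain with nodes $1,\dots,n$ ($n\ge 1$) and edges $(i,i+1)$, and the problem $$\min_{x\in\mathbb R^n} f(x),\qquad f(x)=\sum_{i=1}^{n} f_i(x_i)+\sum_{i=1}^{n-1} f_{i,i+1}(x_{i+1}-x_i),$$ where each $f_i:\mathbb R\to\mathbb R$ is convex and piecewise linear with at most $K$ breakpoints ($K$ a fixed constant), and $f_{i,i+1}(z)=w^-_i z$ for $z<0$, $f_{i,i+1}(z)=w^+_i z$ for $z\ge 0$, with $w^-_i\le w^+_i$. Each $f_i$ is given by its left derivative $g_i$, a non-decreasing left-continuous step function that is described by its value at $-\infty$ and an unsorted list of at most $K$ breakpoints with their increments. For $\lambda\in\mathbb R$ and $y\in\{0,1\}^n$ let $$g_\lambda(y)=\sum_i g_i(\lambda)y_i+\sum_i f_{i,i+1}(y_{i+1}-y_i).$$ The divide-and-conquer algorithm works on a chain and an interval $[a,b]$, initially the whole chain and $a=-\infty$, $b=+\infty$: - If no unary term has a breakpoint, return $x=(a,\dots,a)$. - Otherwise let the pivot $\lambda$ be the median of the multiset $\Lambda$ of all breakpoints, found by linear-time (median-of-medians) selection. - Compute the lowest minimizer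 $y$ of $g_\lambda$ over $\{0,1\}^n$ by dynamic programming: in the forward pass $\widehat m_i=g_i(\lambda)+m_{i-1,i}$ (with $m_{0,1}=0$) and $m_{i,i+1}=\min\{\max\{\widehat m_i,w^-_i\},w^+_i\}$. In the backward pass $y_n=1$ iff $\widehat m_n<0$, and for $i<n$, $y_i=1$ if $\widehat m_i<w^-_i$, $y_i=y_{i+1}$ if $w^-_i\le \widehat m_i<w^+_i$, $y_i=0$ if $\widehat m_i\ge w^+_i$. - Split the chain into the maximal subchains on which $y$ is constant. Recursively solve each subchain with label $0$ over $[a,\lambda]$, having removed its breakpoints $\ge\lambda$, and each subchain with label $1$ over $[\lambda,b]$, having removed its breakpoints $\le\lambda$ (and added their increments to the value of $g_i$ at $-\infty$). In each subproblem the variables of the neighbouring nodes outside the subchain are fixed to $\lambda$. **Proposition.** In the unit-cost model (each arithmetic operation or comparison of two real or two natural numbers and each procedure call is one step) this algorithm has running time $O(n\log n)$: for every $K$ there is a constant $C$, depending only on $K$, such that on every such instance with $n\ge 2$ nodes it makes at most $C\,n\log n$ steps. Moreover, for every $n\ge1$, if the set of minimizers of $f$ over $\mathbb R^n$ has a least element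 $x$ in the component-wise order, then the output of the algorithm is $x$. -/

import Mathlib

/-! ### Cost model

Unit-cost real-number model.  A computation returns a value and the number of elementary steps it
has used.  One step is charged for every call of a procedure (this pays for inspecting the outermost
constructors of the arguments, for branching on Booleans, and for building a bounded number of new
list cells or tuples), and one further step for every arithmetic operation and every comparison of
two real numbers or two natural numbers. -/

/-- A value together with the number of elementary steps that were used to compute it. -/
structure Timed (α : Type) where
  val : α
  cost : ℕ

namespace Timed

instance : Monad Timed where
  pure a := ⟨a, 0⟩
  bind p q := ⟨(q p.val).val, p.cost + (q p.val).cost⟩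

/-- The step charged for a procedure call. -/
def call : Timed Unit := ⟨(), 1⟩

/-- Addition of two numbers, one step. -/
def add {α : Type} [Add α] (x y : α) : Timed α := ⟨x + y, 1⟩

/-- Subtraction of two numbers, one step. -/
def sub {α : Type} [Sub α] (x y : α) : Timed α := ⟨x - y, 1⟩

/-- Halving of an index (rounding down), one step. -/
def half (k : ℕ) : Timed ℕ := ⟨k / 2, 1⟩

open Classical in
/-- Comparison of two numbers, one step. -/
noncomputable def lt {α : Type} [LT α] (x y : α) : Timed Bool := ⟨decide (x < y), 1⟩

end Timed

namespace ChainTV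

open Timed

/-! ### The minimization problem on a chain -/

/-- The convex pairwise term with slope `wm` on the negative and `wp` on the positive half-line. -/
noncomputable def pairTerm (wm wp z : ℝ) : ℝ := if z < 0 then wm * z else wp * z

/-- The objective on a chain with nodes `0, …, N` and edges `(e, e + 1)` for `e < N`. -/
noncomputable def objective {N : ℕ} (f : Fin (N + 1) → ℝ → ℝ) (wm wp : Fin N → ℝ)
    (x : Fin (N + 1) → ℝ) : ℝ :=
  ∑ i, f i (x i) + ∑ e : Fin N, pairTerm (wm e) (wp e) (x e.succ - x e.castSucc)

/-- The data that describe a left-continuous step function: its value `left` at `-∞`, and the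
multiset (as an unsorted list) of its breakpoints `(b, δ)`, with position `b` and increment `δ`. -/
structure StepFn where
  left : ℝ
  bps : List (ℝ × ℝ)

open Classical in
/-- The value at `z`, namely `left` plus all increments at positions smaller than `z`. -/
noncomputable def StepFn.eval (h : StepFn) (z : ℝ) : ℝ :=
  h.left + ((h.bps.filter fun p => p.1 < z).map Prod.snd).sum

/-- The data `h` describe the left derivative of `f`.  A convex function of which this holds is
piecewise linear, all its breakpoints are listed in `h`, and `h` determines it up to a constant. -/
def StepFn.IsLeftDerivOf (h : StepFn) (f : ℝ → ℝ) : Prop :=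
  ∀ z, HasDerivWithinAt f (h.eval z) (Set.Iic z) z

/-- A node of a chain, as the algorithm stores it: the derivative of its unary term, and the weights
of the edge to the next node (both weights are zero at the last node). -/
structure Node where
  g : StepFn
  wm : ℝ
  wp : ℝ

/-- The input of the algorithm: the list of the nodes in the order of the chain.  The last node gets
an edge of weight zero (to a dummy root). -/
noncomputable def input {N : ℕ} (g : Fin (N + 1) → StepFn) (wm wp : Fin N → ℝ) : List Node :=
  List.ofFn fun i : Fin (N + 1) =>
    ⟨g i, (Fin.snoc wm (0 : ℝ) : Fin (N + 1) → ℝ) i, (Fin.snoc wp (0 : ℝ) : Fin (N + 1) → ℝ) i⟩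

/-! ### Procedures on lists -/

/-- Length of a list. -/
def length {α : Type} : List α → Timed ℕ
  | [] => do
      call
      pure 0
  | _ :: l => do
      call
      add (← length l) 1

/-- Concatenation of two lists. -/
def append {α : Type} : List α → List α → Timed (List α)
  | [], r => do
      call
      pure r
  | x :: l, r => do
      call
      pure (x :: (← append l r))

/-- The entry with a given index, counted from zero. -/
def nth : List ℝ → ℕ → Timed ℝ
  | [], _ => do
      call
      pure 0
  | x :: _, 0 => do
      call
      pure x
  | _ :: l, k + 1 => do
      call
      nth l k

/-- Insertion into a sorted list. -/
noncomputable def insert (x : ℝ) : List ℝ → Timed (List ℝ)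
  | [] => do
      call
      pure [x]
  | y :: l => do
      call
      if (← lt y x) then
        pure (y :: (← insert x l))
      else
        pure (x :: y :: l)

/-- Insertion sort (used for lists of bounded length only). -/
noncomputable def insertionSort : List ℝ → Timed (List ℝ)
  | [] => do
      call
      pure []
  | x :: l => do
      call
      insert x (← insertionSort l)

/-! ### Linear-time selection (median of medians) -/

/-- Split off consecutive groups of five entries and return the list of their medians; an incomplete
last group is ignored. -/
noncomputable def mediansOfFive : List ℝ → Timed (List ℝ)
  | a :: b :: c :: d :: e :: l => do
      call
      let s ← insertionSort [a, b, c, d, e]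
      let m ← nth s 2
      pure (m :: (← mediansOfFive l))
  | _ => do
      call
      pure []

/-- The entries smaller than `p`, those equal to `p`, and those larger than `p`. -/
noncomputable def partition (p : ℝ) : List ℝ → Timed (List ℝ × List ℝ × List ℝ)
  | [] => do
      call
      pure ([], [], [])
  | x :: l => do
      call
      let (A, E, B) ← partition p l
      if (← lt x p) then
        pure (x :: A, E, B)
      else if (← lt p x) then
        pure (A, E, x :: B)
      else
        pure (A, x :: E, B)

/-- `select fuel L k` is the entry with index `k` (counted from zero) of the sorted list `L`.  Each
recursive call is for a strictly shorter list, so that `fuel = |L|` is never exhausted. -/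
noncomputable def select : ℕ → List ℝ → ℕ → Timed ℝ
  | 0, _, _ => pure 0
  | fuel + 1, L, k => do
      call
      if (← lt (← length L) 50) then
        nth (← insertionSort L) k
      else
        let M ← mediansOfFive L
        let p ← select fuel M (← half (← length M))
        let (A, E, B) ← partition p L
        let a ← length A
        if (← lt k a) then
          select fuel A k
        else
          let k' ← sub k a
          let e ← length E
          if (← lt k' e) then
            pure p
          else
            select fuel B (← sub k' e)

/-- The (upper) median of a nonempty list. -/
noncomputable def median (L : List ℝ) : Timed ℝ := do
  call
  let m ← length L
  select m L (← half m)

/-! ### The binary problem for a fixed pivot, by dynamic programming -/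

/-- Add to `s` all increments at positions smaller than `z`. -/
noncomputable def evalFrom (z s : ℝ) : List (ℝ × ℝ) → Timed ℝ
  | [] => do
      call
      pure s
  | (b, δ) :: S => do
      call
      if (← lt b z) then
        evalFrom z (← add s δ) S
      else
        evalFrom z s S

/-- Projection to the interval `[lo, hi]`. -/
noncomputable def clip (lo hi v : ℝ) : Timed ℝ := do
  call
  if (← lt v lo) then
    pure lo
  else if (← lt hi v) then
    pure hi
  else
    pure v

/-- Forward pass at the value `z`.  Here `m` is the message that enters the first node of the list.
The message sum `mhat = g(z) + m` of every node is pushed on a stack, with the weights of the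
outgoing edge; the outgoing message is the projection of `mhat` to `[wm, wp]`. -/
noncomputable def forward (z m : ℝ) (stack : List (ℝ × ℝ × ℝ)) :
    List Node → Timed (List (ℝ × ℝ × ℝ))
  | [] => do
      call
      pure stack
  | v :: P => do
      call
      let mhat ← add (← evalFrom z v.g.left v.g.bps) m
      let m' ← clip v.wm v.wp mhat
      forward z m' ((mhat, v.wm, v.wp) :: stack) P

/-- Backward pass, from the last node to the first.  Here `y` is the label of the node behind the
edge in question and `acc` holds the labels found so far; ties are broken towards the label `0`. -/
noncomputable def backward (y : Bool) (acc : List Bool) : List (ℝ × ℝ × ℝ) → Timed (List Bool)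
  | [] => do
      call
      pure acc
  | (mhat, wm, wp) :: stack => do
      call
      if (← lt mhat wm) then
        backward true (true :: acc) stack
      else if (← lt mhat wp) then
        backward y (y :: acc) stack
      else
        backward false (false :: acc) stack

/-- The lowest minimizer `y ∈ {0,1}ⁿ` of the binary problem
`∑ gᵢ(z) yᵢ + ∑ f_{i,i+1}(y_{i+1} - yᵢ)`, computed by a forward and a backward pass. -/
noncomputable def binaryMin (z : ℝ) (P : List Node) : Timed (List Bool) := do
  call
  backward false [] (← forward z 0 [] P)

/-! ### Divide and conquer -/

/-- The breakpoints at positions smaller than `z`. -/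
noncomputable def keepBelow (z : ℝ) : List (ℝ × ℝ) → Timed (List (ℝ × ℝ))
  | [] => do
      call
      pure []
  | (b, δ) :: S => do
      call
      let R ← keepBelow z S
      if (← lt b z) then
        pure ((b, δ) :: R)
      else
        pure R

/-- Remove the breakpoints at positions at most `z`; their increments are added to the value `s`
at `-∞`, so that the function is not changed to the right of `z`. -/
noncomputable def keepAbove (z s : ℝ) : List (ℝ × ℝ) → Timed StepFn
  | [] => do
      call
      pure ⟨s, []⟩
  | (b, δ) :: S => do
      call
      let h ← keepAbove z s S
      if (← lt z b) then
        pure ⟨h.left, (b, δ) :: h.bps⟩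
      else
        pure ⟨← add h.left δ, h.bps⟩

/-- The unary term of a node in the subproblem that its label `y` assigns it to. -/
noncomputable def restrict (z : ℝ) (y : Bool) (h : StepFn) : Timed StepFn := do
  call
  if y then
    keepAbove z h.left h.bps
  else
    pure ⟨h.left, ← keepBelow z h.bps⟩

/-- Split a chain with labels `y` into its maximal subchains of constant label, each returned with
this label.  The pairwise term of an edge between nodes `i, i + 1` with different labels is the
linear function `d * (x_{i+1} - xᵢ)` on the two subproblems (`d = wp` if the labels are `0, 1` and
`d = wm` if they are `1, 0`): with the other endpoint fixed to the pivot `z` it contributes `-d` to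
the slope of the unary term of `i` and `d` to that of `i + 1`.  The argument `c` is the contribution
of this kind that the first node receives from the left. -/
noncomputable def pieces (z c : ℝ) : List Node → List Bool → Timed (List (Bool × List Node))
  | v :: P, y :: ys => do
      call
      let h ← restrict z y v.g
      let s ← add h.left c
      match ys with
      | [] => pure [(y, [⟨⟨s, h.bps⟩, v.wm, v.wp⟩])]
      | y' :: _ =>
        if y == y' then
          match (← pieces z 0 P ys) with
          | [] => pure []
          | (b, Q) :: Qs => pure ((b, ⟨⟨s, h.bps⟩, v.wm, v.wp⟩ :: Q) :: Qs)
        else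
          let d := if y then v.wm else v.wp
          let s' ← sub s d
          let Qs ← pieces z d P ys
          pure ((y, [⟨⟨s', h.bps⟩, 0, 0⟩]) :: Qs)
  | _, _ => do
      call
      pure []

/-- Prepend the positions of a list of breakpoints to a list of numbers. -/
def positions : List (ℝ × ℝ) → List ℝ → Timed (List ℝ)
  | [], r => do
      call
      pure r
  | (b, _) :: S, r => do
      call
      pure (b :: (← positions S r))

/-- The multiset of all breakpoint positions of the unary terms, as an unsorted list. -/
def breakpoints : List Node → Timed (List ℝ)
  | [] => do
      call
      pure []
  | v :: P => do
      call
      positions v.g.bps (← breakpoints P)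

/-- The solution with all coordinates equal to `a`. -/
def fill (a : WithBot ℝ) : List Node → Timed (List (WithBot ℝ))
  | [] => do
      call
      pure []
  | _ :: P => do
      call
      pure (a :: (← fill a P))

/-- Run a procedure on each entry of a list and concatenate the results. -/
def collect {α β : Type} (F : α → Timed (List β)) : List α → Timed (List β)
  | [] => do
      call
      pure []
  | q :: Q => do
      call
      let r ← F q
      append r (← collect F Q)

/-- `solve fuel a P`: the lowest minimizer over `[a, b]ⁿ` for the chain `P` (the upper end `b` of the
interval is not needed in the computation).  If there are no breakpoints the solution is the constant
`a`; otherwise the pivot `z` is the median breakpoint, the binary problem at `z` splits the chain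
into subchains, and these are solved over `[z, b]` (label `1`) or `[a, z]` (label `0`).
Each recursive call is for a chain with strictly fewer breakpoints.  If `fuel` ran out then the
output would have the wrong length. -/
noncomputable def solve : ℕ → WithBot ℝ → List Node → Timed (List (WithBot ℝ))
  | 0, _, _ => pure []
  | fuel + 1, a, P => do
      call
      let L ← breakpoints P
      match L with
      | [] => fill a P
      | _ :: _ =>
        let z ← median L
        let y ← binaryMin z P
        let Qs ← pieces z 0 P y
        collect (fun Q => solve fuel (if Q.1 then (z : WithBot ℝ) else a) Q.2) Qs

/-- The divide-and-conquer algorithm: the initial interval is `(-∞, ∞)`, and the recursion depth is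
at most the number of breakpoints plus one. -/
noncomputable def minimize (P : List Node) : Timed (List (WithBot ℝ)) := do
  call
  let k ← length (← breakpoints P)
  solve (← add k 1) ⊥ P

end ChainTV

/-! Running time. Take a chain with `n` nodes and `T > 0` breakpoints. Selecting the median, running
the dynamic program and splitting the chain cost `O(n + T)`; for the selection this is the
median-of-medians recursion (`select_cost_le`). The pieces together have at most `n` nodes and at
most `T` breakpoints (`pieces_size`), and each single piece keeps at most `T / 2` breakpoints
because the pivot is a median. Hence the binary length of `T` drops by at least one per level, and
the total is `O((n + T) (log T + 1))` (`solve_cost_le`) with `T ≤ K n`.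

Correctness. Everything is expressed by thresholds: if `x` is the least minimizer of the objective,
then for every real `t` the dynamic program at `t` returns exactly the labels `[t ≤ x i]`
(`labels_input`). The messages serve as dual variables. A node's residual, its slope plus incoming
minus outgoing message, is nonpositive at label 1 and nonnegative at label 0, and each message is a
slope that bounds the relevant change of its edge term. Thus neither raising the 1-nodes of a
minimizer to `t` nor lowering its 0-nodes to `t` increases the objective. Leastness then gives `x i
≤ t` at label 0; at label 1 all slacks vanish, and going backwards along the chain yields `t ≤ x i`.

This threshold description, restricted to the values in `(a, b]`, is the invariant `IsSolution` of
the recursion. It passes to the pieces (`isSolution_pieces`) because message sums are monotone in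
`t`: if the labels at the pivot differ across an edge, the message over that edge is constant on the
whole interval of the right piece, and the label across the edge is constant on the whole interval
of the left piece. So both sides see the edge as a linear term. Without breakpoints the labels do
not depend on `t`, which forces every coordinate to be `a` (`solve_val`). -/

namespace Timed

/-! ### Values and costs of the elementary operations -/

@[simp] theorem val_pure {α : Type} (a : α) : (pure a : Timed α).val = a := rfl
@[simp] theorem cost_pure {α : Type} (a : α) : (pure a : Timed α).cost = 0 := rfl
@[simp] theorem val_bind {α β : Type} (p : Timed α) (q : α → Timed β) :
    (p >>= q).val = (q p.val).val := rfl
@[simp] theorem cost_bind {α β : Type} (p : Timed α) (q : α → Timed β) :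
    (p >>= q).cost = p.cost + (q p.val).cost := rfl
@[simp] theorem cost_call : call.cost = 1 := rfl
@[simp] theorem val_add {α : Type} [Add α] (x y : α) : (add x y).val = x + y := rfl
@[simp] theorem cost_add {α : Type} [Add α] (x y : α) : (add x y).cost = 1 := rfl
@[simp] theorem val_sub {α : Type} [Sub α] (x y : α) : (sub x y).val = x - y := rfl
@[simp] theorem cost_sub {α : Type} [Sub α] (x y : α) : (sub x y).cost = 1 := rfl
@[simp] theorem val_half (k : ℕ) : (half k).val = k / 2 := rfl
@[simp] theorem cost_half (k : ℕ) : (half k).cost = 1 := rfl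
@[simp] theorem val_lt {α : Type} [LT α] (x y : α) : ((lt x y).val = true) = (x < y) := by
  simp [lt]
@[simp] theorem cost_lt {α : Type} [LT α] (x y : α) : (lt x y).cost = 1 := rfl
theorem val_ite {α : Type} (c : Prop) [Decidable c] (p q : Timed α) :
    (if c then p else q).val = if c then p.val else q.val := by split_ifs <;> rfl
theorem cost_ite {α : Type} (c : Prop) [Decidable c] (p q : Timed α) :
    (if c then p else q).cost = if c then p.cost else q.cost := by split_ifs <;> rfl

end Timed

namespace ChainTV

open Timed

/-! ### Values and costs of the procedures on lists -/

@[simp] theorem length_val {α : Type} (l : List α) : (length l).val = l.length := by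
  induction l with
  | nil => rfl
  | cons x l ih => simp [length, ih]

@[simp] theorem length_cost {α : Type} (l : List α) : (length l).cost = 2 * l.length + 1 := by
  induction l with
  | nil => rfl
  | cons x l ih => simp [length, ih]; omega

@[simp] theorem append_val {α : Type} (l r : List α) : (append l r).val = l ++ r := by
  induction l with
  | nil => rfl
  | cons x l ih => simp [append, ih]

@[simp] theorem append_cost {α : Type} (l r : List α) : (append l r).cost = l.length + 1 := by
  induction l with
  | nil => rfl
  | cons x l ih => simp [append, ih]; omega

@[simp] theorem nth_val (l : List ℝ) (k : ℕ) : (nth l k).val = l.getD k 0 := by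
  induction l generalizing k with
  | nil => simp [nth]
  | cons x l ih => cases k <;> simp [nth, ih]

theorem nth_cost_le (l : List ℝ) (k : ℕ) : (nth l k).cost ≤ l.length + 1 := by
  induction l generalizing k with
  | nil => simp [nth]
  | cons x l ih =>
    cases k with
    | zero => simp [nth]
    | succ k => have := ih k; simp [nth]; omega

theorem insert_val_perm (x : ℝ) (l : List ℝ) : ((insert x l).val).Perm (x :: l) := by
  induction l with
  | nil => simp [insert]
  | cons y l ih =>
    simp only [insert, val_bind, val_ite, val_lt, val_pure]
    split_ifs
    · exact (ih.cons y).trans (List.Perm.swap x y l)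
    · exact List.Perm.refl _

theorem insert_val_sorted (x : ℝ) (l : List ℝ) (hl : l.Pairwise (· ≤ ·)) :
    ((insert x l).val).Pairwise (· ≤ ·) := by
  induction l with
  | nil => simp [insert]
  | cons y l ih =>
    simp only [insert, val_bind, val_ite, val_lt, val_pure]
    rw [List.pairwise_cons] at hl
    split_ifs with h
    · refine List.pairwise_cons.2 ⟨fun w hw => ?_, ih hl.2⟩
      rcases List.mem_cons.1 ((insert_val_perm x l).mem_iff.1 hw) with rfl | hw
      · exact h.le
      · exact hl.1 w hw
    · refine List.pairwise_cons.2 ⟨fun w hw => ?_, List.pairwise_cons.2 hl⟩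
      rcases List.mem_cons.1 hw with rfl | hw
      · exact not_lt.1 h
      · exact (not_lt.1 h).trans (hl.1 w hw)

theorem insert_cost_le (x : ℝ) (l : List ℝ) : (insert x l).cost ≤ 2 * l.length + 1 := by
  induction l with
  | nil => simp [insert]
  | cons y l ih =>
    simp only [insert, cost_bind, cost_ite, cost_pure, cost_call, cost_lt, List.length_cons]
    split_ifs <;> omega

theorem insertionSort_val_perm (l : List ℝ) : ((insertionSort l).val).Perm l := by
  induction l with
  | nil => simp [insertionSort]
  | cons x l ih => exact (insert_val_perm x _).trans (ih.cons x)

theorem insertionSort_val_sorted (l : List ℝ) : ((insertionSort l).val).Pairwise (· ≤ ·) := by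
  induction l with
  | nil => simp [insertionSort]
  | cons x l ih => exact insert_val_sorted x _ ih

theorem insertionSort_cost_le (l : List ℝ) (m : ℕ) (hm : l.length ≤ m) :
    (insertionSort l).cost ≤ (2 * m + 2) * l.length + 1 := by
  induction l with
  | nil => simp [insertionSort]
  | cons x l ih =>
    have h1 := insert_cost_le x (insertionSort l).val
    rw [(insertionSort_val_perm l).length_eq] at h1
    simp only [List.length_cons] at hm
    have h2 := ih (by omega)
    simp only [insertionSort, cost_bind, cost_call, List.length_cons, mul_add, mul_one]
    omega

/-! ### Selection -/

open Classical in
/-- Number of entries of `L` that are smaller than `r`. -/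
noncomputable def countLT (r : ℝ) (L : List ℝ) : ℕ := L.countP fun x => decide (x < r)

open Classical in
/-- Number of entries of `L` that are larger than `r`. -/
noncomputable def countGT (r : ℝ) (L : List ℝ) : ℕ := L.countP fun x => decide (r < x)

@[simp] theorem countLT_nil (r : ℝ) : countLT r [] = 0 := rfl
@[simp] theorem countGT_nil (r : ℝ) : countGT r [] = 0 := rfl

open Classical in
theorem countLT_cons (r x : ℝ) (L : List ℝ) :
    countLT r (x :: L) = countLT r L + if x < r then 1 else 0 := by
  simp [countLT, List.countP_cons]

open Classical in
theorem countGT_cons (r x : ℝ) (L : List ℝ) :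
    countGT r (x :: L) = countGT r L + if r < x then 1 else 0 := by
  simp [countGT, List.countP_cons]

theorem countLT_append (r : ℝ) (L M : List ℝ) :
    countLT r (L ++ M) = countLT r L + countLT r M := by
  simp [countLT, List.countP_append]

theorem countGT_append (r : ℝ) (L M : List ℝ) :
    countGT r (L ++ M) = countGT r L + countGT r M := by
  simp [countGT, List.countP_append]

theorem countLT_le_length (r : ℝ) (L : List ℝ) : countLT r L ≤ L.length := List.countP_le_length
theorem countGT_le_length (r : ℝ) (L : List ℝ) : countGT r L ≤ L.length := List.countP_le_length

theorem countLT_eq_zero {r : ℝ} {L : List ℝ} (h : ∀ x ∈ L, r ≤ x) : countLT r L = 0 := by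
  simpa [countLT, List.countP_eq_zero] using h

theorem countGT_eq_zero {r : ℝ} {L : List ℝ} (h : ∀ x ∈ L, x ≤ r) : countGT r L = 0 := by
  simpa [countGT, List.countP_eq_zero] using h

/-- `r` is an entry with index `k` of the sorted list `L`. -/
def IsKth (L : List ℝ) (k : ℕ) (r : ℝ) : Prop :=
  r ∈ L ∧ countLT r L ≤ k ∧ k + countGT r L < L.length

theorem isKth_getD_of_sorted {s : List ℝ} (hs : s.Pairwise (· ≤ ·)) {k : ℕ} (hk : k < s.length) :
    IsKth s k (s.getD k 0) := by
  rw [List.getD_eq_getElem _ _ hk]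
  have hsplit : s = s.take k ++ s[k] :: s.drop (k + 1) := by simp
  have h2 : (s.take k ++ s[k] :: s.drop (k + 1)).Pairwise (· ≤ ·) := by rwa [← hsplit]
  rw [List.pairwise_append, List.pairwise_cons] at h2
  obtain ⟨-, ⟨h3, -⟩, h4⟩ := h2
  have hmem : s[k] ∈ s := List.getElem_mem hk
  generalize s[k] = r at *
  refine ⟨hmem, ?_, ?_⟩
  · rw [hsplit, countLT_append, countLT_eq_zero (L := r :: _)]
    · exact (countLT_le_length _ _).trans (by simp)
    · intro x hx
      rcases List.mem_cons.1 hx with rfl | hx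
      · exact le_rfl
      · exact h3 x hx
  · have h5 : countGT r s = countGT r (s.drop (k + 1)) := by
      conv_lhs => rw [hsplit]
      rw [countGT_append, countGT_cons, countGT_eq_zero (L := s.take k)]
      · simp
      · exact fun x hx => h4 x hx _ List.mem_cons_self
    rw [h5]
    have := countGT_le_length r (s.drop (k + 1))
    rw [List.length_drop] at this
    omega

theorem IsKth.perm {L M : List ℝ} (h : L.Perm M) {k : ℕ} {r : ℝ} (hL : IsKth L k r) :
    IsKth M k r := by
  refine ⟨h.mem_iff.1 hL.1, ?_, ?_⟩
  · rw [countLT, ← h.countP_eq]; exact hL.2.1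
  · rw [countGT, ← h.countP_eq, ← h.length_eq]; exact hL.2.2

theorem isKth_insertionSort (L : List ℝ) {k : ℕ} (hk : k < L.length) :
    IsKth L k ((insertionSort L).val.getD k 0) :=
  (isKth_getD_of_sorted (insertionSort_val_sorted L)
    (by rwa [(insertionSort_val_perm L).length_eq])).perm (insertionSort_val_perm L)

theorem mediansOfFive_length (L : List ℝ) : (mediansOfFive L).val.length = L.length / 5 := by
  fun_induction mediansOfFive L with
  | case1 a b c d e l ih => simp [ih]; omega
  | case2 L h =>
    match L, h with
    | [], _ | [_], _ | [_, _], _ | [_, _, _], _ | [_, _, _, _], _ => simp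
    | a :: b :: c :: d :: e :: l, h => exact absurd rfl (h a b c d e l)

theorem mediansOfFive_cost_le (L : List ℝ) : (mediansOfFive L).cost ≤ 20 * L.length + 1 := by
  fun_induction mediansOfFive L with
  | case1 a b c d e l ih =>
    have h1 := insertionSort_cost_le [a, b, c, d, e] 5 le_rfl
    have h2 := nth_cost_le (insertionSort [a, b, c, d, e]).val 2
    rw [(insertionSort_val_perm _).length_eq] at h2
    simp only [cost_bind, cost_call, cost_pure, List.length_cons, List.length_nil] at *
    omega
  | case2 L h => simp

/-- If the median of a group is at most `p`, so are at least three of its five entries, and dually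
for `≥`. With `p` the median of the medians, this puts roughly 3/10 of the entries on the wrong side
of either recursive call. -/
theorem mediansOfFive_count (p : ℝ) (L : List ℝ) :
    3 * ((mediansOfFive L).val.length - countGT p (mediansOfFive L).val) ≤
        L.length - countGT p L ∧
      3 * ((mediansOfFive L).val.length - countLT p (mediansOfFive L).val) ≤
        L.length - countLT p L := by
  fun_induction mediansOfFive L with
  | case1 a b c d e l ih =>
    have hk := isKth_insertionSort [a, b, c, d, e] (k := 2) (by simp)
    simp only [val_bind, val_pure, nth_val]
    generalize (insertionSort [a, b, c, d, e]).val.getD 2 0 = r at *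
    have e1 : a :: b :: c :: d :: e :: l = [a, b, c, d, e] ++ l := rfl
    obtain ⟨-, h1, h2⟩ := hk
    generalize [a, b, c, d, e] = G at *
    have b1 := countLT_le_length p G
    have b2 := countGT_le_length p G
    have b3 := countLT_le_length p l
    have b4 := countGT_le_length p l
    have b5 := countLT_le_length p (mediansOfFive l).val
    have b6 := countGT_le_length p (mediansOfFive l).val
    rw [e1, countGT_append, countLT_append, countGT_cons, countLT_cons, List.length_append,
      List.length_cons]
    have hG : G.length = 5 := by
      have := congrArg List.length e1
      simp at this; omega
    have m1 : r ≤ p → countGT p G ≤ countGT r G := fun h => by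
      refine List.countP_mono_left fun x _ hx => ?_
      simp only [decide_eq_true_eq] at *
      exact h.trans_lt hx
    have m2 : p ≤ r → countLT p G ≤ countLT r G := fun h => by
      refine List.countP_mono_left fun x _ hx => ?_
      simp only [decide_eq_true_eq] at *
      exact hx.trans_le h
    obtain ⟨ih1, ih2⟩ := ih
    constructor
    · split_ifs with h
      · omega
      · have := m1 (not_lt.1 h); omega
    · split_ifs with h
      · omega
      · have := m2 (not_lt.1 h); omega
  | case2 L h => simp

open Classical in
theorem partition_val (p : ℝ) (L : List ℝ) :
    (partition p L).val = (L.filter fun x => x < p, L.filter fun x => x = p,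
      L.filter fun x => p < x) := by
  induction L with
  | nil => simp [partition]
  | cons x l ih =>
    simp only [partition, val_bind, val_ite, val_lt, val_pure, ih]
    rcases lt_trichotomy x p with h | h | h
    · simp [h, h.ne, h.not_gt]
    · simp [h]
    · simp [h, h.ne', h.not_gt]

theorem partition_cost_le (p : ℝ) (L : List ℝ) : (partition p L).cost ≤ 3 * L.length + 1 := by
  induction L with
  | nil => simp [partition]
  | cons x l ih =>
    simp only [partition, cost_bind, cost_ite, cost_lt, cost_pure, cost_call, List.length_cons]
    split_ifs <;> omega

open Classical in
theorem length_filter_lt (p : ℝ) (L : List ℝ) :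
    (L.filter fun x => decide (x < p)).length = countLT p L := List.countP_eq_length_filter.symm

open Classical in
theorem length_filter_gt (p : ℝ) (L : List ℝ) :
    (L.filter fun x => decide (p < x)).length = countGT p L := List.countP_eq_length_filter.symm

open Classical in
theorem count_partition (p : ℝ) (L : List ℝ) :
    countLT p L + (L.filter fun x => decide (x = p)).length + countGT p L = L.length := by
  induction L with
  | nil => simp
  | cons x l ih =>
    rw [countLT_cons, countGT_cons, List.filter_cons]
    rcases lt_trichotomy x p with h | h | h
    · simp [h, h.ne, h.not_gt]; omega
    · simp [h]; omega
    · simp [h, h.ne', h.not_gt]; omega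

open Classical in
theorem IsKth.of_filter_lt {L : List ℝ} {p r : ℝ} {k : ℕ}
    (h : IsKth (L.filter fun x => decide (x < p)) k r) : IsKth L k r := by
  obtain ⟨h1, h2, h3⟩ := h
  rw [List.mem_filter, decide_eq_true_eq] at h1
  refine ⟨h1.1, ?_, ?_⟩
  · rw [countLT, List.countP_filter] at h2
    refine le_trans (le_of_eq (List.countP_congr fun x _ => ?_)) h2
    simp only [Bool.and_eq_true, decide_eq_true_eq]
    exact ⟨fun h => ⟨h, h.trans h1.2⟩, fun h => h.1⟩
  · rw [length_filter_lt, countGT, List.countP_filter] at h3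
    -- Since `r < p`, every entry is above `r` or below `p`; only the inequality half of
    -- inclusion–exclusion is needed.
    have : countGT r L + countLT p L ≤
        (L.countP fun x => decide (r < x) && decide (x < p)) + L.length := by
      clear h2 h3
      obtain ⟨-, h1⟩ := h1
      induction L with
      | nil => simp
      | cons x l ih =>
        rw [countGT_cons, countLT_cons, List.countP_cons, List.length_cons]
        by_cases a : r < x <;> by_cases b : x < p <;> simp [a, b] <;> omega
    omega

open Classical in
-- The index shift is the number of entries at most `p`, all of which lie below `r`.
theorem IsKth.of_filter_gt {L : List ℝ} {p r : ℝ} {k : ℕ}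
    (h : IsKth (L.filter fun x => decide (p < x)) k r) :
    IsKth L (k + (L.length - countGT p L)) r := by
  obtain ⟨h1, h2, h3⟩ := h
  rw [List.mem_filter, decide_eq_true_eq] at h1
  have hb := countGT_le_length p L
  refine ⟨h1.1, ?_, ?_⟩
  · rw [countLT, List.countP_filter] at h2
    have : countLT r L + countGT p L ≤
        (L.countP fun x => decide (x < r) && decide (p < x)) + L.length := by
      clear h2 h3 hb
      obtain ⟨-, h1⟩ := h1
      induction L with
      | nil => simp
      | cons x l ih =>
        rw [countGT_cons, countLT_cons, List.countP_cons, List.length_cons]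
        by_cases a : x < r <;> by_cases b : p < x <;> simp [a, b] <;> omega
    omega
  · rw [length_filter_gt, countGT, List.countP_filter] at h3
    have : countGT r L = L.countP fun x => decide (r < x) && decide (p < x) := by
      refine List.countP_congr fun x _ => ?_
      simp only [Bool.and_eq_true, decide_eq_true_eq]
      exact ⟨fun h => ⟨h, h1.2.trans h⟩, fun h => h.1⟩
    omega

theorem select_val (fuel : ℕ) (L : List ℝ) (k : ℕ) (hf : L.length ≤ fuel) (hk : k < L.length) :
    IsKth L k (select fuel L k).val := by
  classical
  induction fuel generalizing L k with
  | zero => omega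
  | succ fuel ih =>
    simp only [select, val_bind, val_ite, val_lt, length_val, nth_val, val_half, val_sub,
      partition_val, val_pure]
    split_ifs with h1 h2 h3
    · exact isKth_insertionSort L hk
    -- The fuel suffices: some median is not below `p`, hence some entry of `L` is not, and the
    -- filtered list is strictly shorter.
    · exact (ih _ k (by rw [length_filter_lt] at *; have := mediansOfFive_length L
                        have hp := ih (mediansOfFive L).val _ (by omega) (by omega :
                          (mediansOfFive L).val.length / 2 < _)
                        have := mediansOfFive_count
                          (select fuel (mediansOfFive L).val
                            ((mediansOfFive L).val.length / 2)).val L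
                        have := hp.2
                        omega) h2).of_filter_lt
    · have hl := mediansOfFive_length L
      have hp := ih (mediansOfFive L).val _ (by omega) (by omega :
        (mediansOfFive L).val.length / 2 < _)
      generalize (select fuel (mediansOfFive L).val ((mediansOfFive L).val.length / 2)).val = p at *
      have hc := count_partition p L
      rw [length_filter_lt] at *
      -- Here `k` falls into the block of entries equal to `p`; this block is nonempty, which also
      -- shows `p ∈ L`.
      refine ⟨?_, by omega, by omega⟩
      obtain ⟨x, hx⟩ := List.exists_mem_of_length_pos (by omega :
        0 < (L.filter fun x => decide (x = p)).length)
      rw [List.mem_filter, decide_eq_true_eq] at hx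
      exact hx.2 ▸ hx.1
    · have hl := mediansOfFive_length L
      have hp := ih (mediansOfFive L).val _ (by omega) (by omega :
        (mediansOfFive L).val.length / 2 < _)
      generalize (select fuel (mediansOfFive L).val ((mediansOfFive L).val.length / 2)).val = p at *
      have hc := count_partition p L
      have hm := mediansOfFive_count p L
      have hp2 := hp.2
      rw [length_filter_lt] at *
      have := (ih (L.filter fun x => decide (p < x))
        (k - countLT p L - (L.filter fun x => decide (x = p)).length)
        (by rw [length_filter_gt]; omega) (by rw [length_filter_gt]; omega)).of_filter_gt
      convert this using 1
      omega

/-- The two recursive calls are for lists of length at most `n / 5` and about `7 n / 10`, so a tenth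
of `1500 n` remains to pay for the linear work. Rounding and the additive constants are absorbed
because `n ≥ 50`; below that, insertion sort has bounded cost per entry. -/
theorem select_cost_le (fuel : ℕ) (L : List ℝ) (k : ℕ) (hf : L.length ≤ fuel) :
    (select fuel L k).cost ≤ 1500 * L.length + 100 := by
  classical
  induction fuel generalizing L k with
  | zero => simp [select]
  | succ fuel ih =>
    simp only [select, cost_bind, cost_ite, cost_lt, length_val, length_cost, cost_half, val_half,
      cost_sub, val_lt, val_sub, partition_val, cost_pure, cost_call]
    by_cases h1 : L.length < 50
    · rw [if_pos h1]
      have a1 := insertionSort_cost_le L 50 (by omega)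
      have a2 := nth_cost_le (insertionSort L).val k
      rw [(insertionSort_val_perm L).length_eq] at a2
      omega
    · rw [if_neg h1]
      have hl := mediansOfFive_length L
      have hlc := mediansOfFive_cost_le L
      have hpc := ih (mediansOfFive L).val ((mediansOfFive L).val.length / 2) (by omega)
      have hp := select_val fuel (mediansOfFive L).val ((mediansOfFive L).val.length / 2)
        (by omega) (by omega)
      generalize (select fuel (mediansOfFive L).val ((mediansOfFive L).val.length / 2)).val = p at *
      have hc := count_partition p L
      have hm := mediansOfFive_count p L
      have hp2 := hp.2
      have hpt := partition_cost_le p L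
      have hA := ih (L.filter fun x => decide (x < p)) k (by rw [length_filter_lt]; omega)
      have hB := ih (L.filter fun x => decide (p < x))
        (k - (L.filter fun x => decide (x < p)).length -
          (L.filter fun x => decide (x = p)).length)
        (by rw [length_filter_gt]; omega)
      rw [length_filter_lt] at *
      rw [length_filter_gt] at hB
      split_ifs <;> omega

theorem median_val {L : List ℝ} (hL : L ≠ []) : IsKth L (L.length / 2) (median L).val := by
  have := List.length_pos_iff.2 hL
  simpa [median] using select_val L.length L (L.length / 2) le_rfl (by omega)

theorem median_cost_le (L : List ℝ) : (median L).cost ≤ 1502 * L.length + 103 := by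
  have := select_cost_le L.length L (L.length / 2) le_rfl
  simp [median]; omega

/-! ### Breakpoints and restrictions of step functions -/

/-- The list of all breakpoint positions of a chain. -/
def bpList (P : List Node) : List ℝ := P.flatMap fun v => v.g.bps.map Prod.fst

@[simp] theorem bpList_nil : bpList [] = [] := rfl

@[simp] theorem bpList_cons (v : Node) (P : List Node) :
    bpList (v :: P) = v.g.bps.map Prod.fst ++ bpList P := rfl

theorem positions_val (S : List (ℝ × ℝ)) (r : List ℝ) :
    (positions S r).val = S.map Prod.fst ++ r := by
  induction S with
  | nil => rfl
  | cons p S ih => simp [positions, ih]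

theorem positions_cost (S : List (ℝ × ℝ)) (r : List ℝ) : (positions S r).cost = S.length + 1 := by
  induction S with
  | nil => rfl
  | cons p S ih => simp [positions, ih]; omega

theorem breakpoints_val (P : List Node) : (breakpoints P).val = bpList P := by
  induction P with
  | nil => rfl
  | cons v P ih => simp [breakpoints, ih, positions_val]

theorem breakpoints_cost (P : List Node) :
    (breakpoints P).cost = 2 * P.length + (bpList P).length + 1 := by
  induction P with
  | nil => rfl
  | cons v P ih => simp [breakpoints, ih, positions_cost]; omega

open Classical in
theorem eval_cons (s b δ : ℝ) (S : List (ℝ × ℝ)) (t : ℝ) :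
    StepFn.eval ⟨s, (b, δ) :: S⟩ t = StepFn.eval ⟨s, S⟩ t + if b < t then δ else 0 := by
  by_cases h : b < t <;> simp [StepFn.eval, h]
  ring

theorem eval_nil (s t : ℝ) : StepFn.eval ⟨s, []⟩ t = s := by simp [StepFn.eval]

theorem eval_add_left (s c : ℝ) (S : List (ℝ × ℝ)) (t : ℝ) :
    StepFn.eval ⟨s + c, S⟩ t = StepFn.eval ⟨s, S⟩ t + c := by
  simp only [StepFn.eval]; ring

theorem eval_eq_of_forall {h : StepFn} {s t : ℝ} (hst : ∀ p ∈ h.bps, (p.1 < s ↔ p.1 < t)) :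
    h.eval s = h.eval t := by
  classical
  obtain ⟨l, S⟩ := h
  induction S with
  | nil => simp [eval_nil]
  | cons p S ih =>
    obtain ⟨b, δ⟩ := p
    rw [eval_cons, eval_cons, ih fun p hp => hst p (List.mem_cons_of_mem _ hp)]
    have := hst (b, δ) List.mem_cons_self
    simp only at this
    simp only [this]

theorem evalFrom_val (z s : ℝ) (S : List (ℝ × ℝ)) :
    (evalFrom z s S).val = StepFn.eval ⟨s, S⟩ z := by
  induction S generalizing s with
  | nil => simp [evalFrom, eval_nil]
  | cons p S ih =>
    obtain ⟨b, δ⟩ := p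
    simp only [evalFrom, val_bind, val_ite, val_lt, val_add, ih, eval_cons, eval_add_left]
    split_ifs <;> simp

theorem evalFrom_cost_le (z s : ℝ) (S : List (ℝ × ℝ)) :
    (evalFrom z s S).cost ≤ 3 * S.length + 1 := by
  induction S generalizing s with
  | nil => simp [evalFrom]
  | cons p S ih =>
    obtain ⟨b, δ⟩ := p
    have h1 := ih s
    have h2 := ih (s + δ)
    simp only [evalFrom, cost_bind, cost_ite, cost_lt, cost_add, val_add, cost_call,
      List.length_cons]
    split_ifs <;> omega

open Classical in
theorem keepBelow_val (z : ℝ) (S : List (ℝ × ℝ)) :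
    (keepBelow z S).val = S.filter fun p => p.1 < z := by
  induction S with
  | nil => rfl
  | cons p S ih =>
    obtain ⟨b, δ⟩ := p
    simp only [keepBelow, val_bind, val_ite, val_lt, val_pure, ih, List.filter_cons,
      decide_eq_true_eq]

theorem keepBelow_cost (z : ℝ) (S : List (ℝ × ℝ)) : (keepBelow z S).cost = 2 * S.length + 1 := by
  induction S with
  | nil => rfl
  | cons p S ih =>
    obtain ⟨b, δ⟩ := p
    simp only [keepBelow, cost_bind, cost_ite, cost_lt, cost_pure, cost_call, ih, List.length_cons,
      ite_self]
    omega

open Classical in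
theorem keepAbove_val_bps (z s : ℝ) (S : List (ℝ × ℝ)) :
    (keepAbove z s S).val.bps = S.filter fun p => z < p.1 := by
  induction S with
  | nil => rfl
  | cons p S ih =>
    obtain ⟨b, δ⟩ := p
    simp only [keepAbove, val_bind, val_ite, val_lt, val_pure, List.filter_cons, decide_eq_true_eq]
    split_ifs <;> simp [ih]

/-- A removed breakpoint is at most `z < t`, so its increment counts at `t` whether it is listed or
part of `left`. -/
theorem keepAbove_val_eval (z s : ℝ) (S : List (ℝ × ℝ)) {t : ℝ} (ht : z < t) :
    (keepAbove z s S).val.eval t = StepFn.eval ⟨s, S⟩ t := by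
  induction S with
  | nil => rfl
  | cons p S ih =>
    obtain ⟨b, δ⟩ := p
    simp only [keepAbove, val_bind, val_ite, val_lt, val_pure, val_add]
    rw [eval_cons, ← ih]
    split_ifs with h1 h2 h2
    · rw [eval_cons, if_pos h2]
    · rw [eval_cons, if_neg h2]
    · rw [eval_add_left]
    · exact absurd ((not_lt.1 h1).trans_lt ht) h2

theorem keepAbove_cost_le (z s : ℝ) (S : List (ℝ × ℝ)) :
    (keepAbove z s S).cost ≤ 3 * S.length + 1 := by
  induction S with
  | nil => simp [keepAbove]
  | cons p S ih =>
    obtain ⟨b, δ⟩ := p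
    simp only [keepAbove, cost_bind, cost_ite, cost_lt, cost_add, cost_pure, cost_call,
      List.length_cons]
    split_ifs <;> omega

/-- The positions that remain after a restriction to the side of the label `y` of the pivot `z`. -/
def OnSide (z : ℝ) (y : Bool) (b : ℝ) : Prop := if y then z < b else b < z

open Classical in
theorem restrict_val_bps (z : ℝ) (y : Bool) (h : StepFn) :
    (restrict z y h).val.bps = h.bps.filter fun p => OnSide z y p.1 := by
  cases y <;> simp [restrict, OnSide, keepBelow_val, keepAbove_val_bps]

theorem restrict_val_eval_true {z t : ℝ} (h : StepFn) (ht : z < t) :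
    (restrict z true h).val.eval t = h.eval t := by
  simp [restrict, keepAbove_val_eval _ _ _ ht]

/-- The end `t = z` is included by left continuity: a breakpoint at `z` contributes only beyond `z`.
This is why the windows below are half-open. -/
theorem restrict_val_eval_false {z t : ℝ} (h : StepFn) (ht : t ≤ z) :
    (restrict z false h).val.eval t = h.eval t := by
  have : ∀ p : ℝ × ℝ, (p.1 < t ∧ p.1 < z) ↔ p.1 < t := fun p => and_iff_left_of_imp ht.trans_lt'
  simp [restrict, keepBelow_val, StepFn.eval, List.filter_filter, ← Bool.decide_and, this]

theorem restrict_cost_le (z : ℝ) (y : Bool) (h : StepFn) :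
    (restrict z y h).cost ≤ 3 * h.bps.length + 2 := by
  have h1 := keepAbove_cost_le z h.left h.bps
  have h2 := keepBelow_cost z h.bps
  cases y <;> simp [restrict] <;> omega

/-! ### The dynamic program -/

/-- Projection to `[lo, hi]`. -/
noncomputable def proj (lo hi v : ℝ) : ℝ := if v < lo then lo else if hi < v then hi else v

theorem clip_val (lo hi v : ℝ) : (clip lo hi v).val = proj lo hi v := by
  simp [clip, val_ite, proj]

theorem clip_cost_le (lo hi v : ℝ) : (clip lo hi v).cost ≤ 3 := by
  simp only [clip, cost_bind, cost_ite, cost_lt, cost_call, cost_pure]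
  split_ifs <;> omega

theorem proj_mono {lo hi : ℝ} (h : lo ≤ hi) : Monotone (proj lo hi) := by
  intro v w hvw
  simp only [proj]
  split_ifs <;> linarith

/-- The label of a node with message sum `m`, if `y` is the label of the next node. -/
noncomputable def label (m wm wp : ℝ) (y : Bool) : Bool :=
  if m < wm then true else if m < wp then y else false

/-- The labels that the dynamic program at the value `z` assigns to the chain `P`, if the first node
receives the message `m`. -/
noncomputable def labels (z m : ℝ) : List Node → List Bool
  | [] => []
  | v :: P =>
    let ys := labels z (proj v.wm v.wp (v.g.eval z + m)) P
    label (v.g.eval z + m) v.wm v.wp (ys.headD false) :: ys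

theorem backward_cons (y : Bool) (acc : List Bool) (m wm wp : ℝ) (st : List (ℝ × ℝ × ℝ)) :
    (backward y acc ((m, wm, wp) :: st)).val =
      (backward (label m wm wp y) (label m wm wp y :: acc) st).val := by
  simp only [backward, val_bind, val_ite, val_lt, label]
  split_ifs <;> rfl

/-- Links the two passes with the structural recursion `labels`. The induction needs an arbitrary
stack `st` of earlier nodes: once the entries of `P` are popped, the pass continues on `st` with the
labels of `P` accumulated. -/
theorem backward_forward (z m : ℝ) (st : List (ℝ × ℝ × ℝ)) (P : List Node) :
    (backward false [] (forward z m st P).val).val =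
      (backward ((labels z m P).headD false) (labels z m P) st).val := by
  induction P generalizing m st with
  | nil => simp [forward, labels]
  | cons v P ih =>
    simp only [forward, val_bind, val_add, clip_val, evalFrom_val, ih, backward_cons, labels,
      List.headD_cons]

theorem binaryMin_val (z : ℝ) (P : List Node) : (binaryMin z P).val = labels z 0 P := by
  simp [binaryMin, backward_forward, backward]

theorem forward_cost_le (z m : ℝ) (st : List (ℝ × ℝ × ℝ)) (P : List Node) :
    (forward z m st P).cost ≤ 6 * P.length + 3 * (bpList P).length + 1 := by
  induction P generalizing m st with
  | nil => simp [forward]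
  | cons v P ih =>
    have h1 := evalFrom_cost_le z v.g.left v.g.bps
    have h2 := clip_cost_le v.wm v.wp ((evalFrom z v.g.left v.g.bps).val + m)
    have h3 := ih (clip v.wm v.wp ((evalFrom z v.g.left v.g.bps).val + m)).val
      (((evalFrom z v.g.left v.g.bps).val + m, v.wm, v.wp) :: st)
    simp only [forward, cost_bind, cost_call, cost_add, val_add, List.length_cons, bpList_cons,
      List.length_append, List.length_map]
    omega

theorem forward_val_length (z m : ℝ) (st : List (ℝ × ℝ × ℝ)) (P : List Node) :
    (forward z m st P).val.length = st.length + P.length := by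
  induction P generalizing m st with
  | nil => simp [forward]
  | cons v P ih => simp [forward, ih]; omega

theorem backward_cost_le (y : Bool) (acc : List Bool) (st : List (ℝ × ℝ × ℝ)) :
    (backward y acc st).cost ≤ 3 * st.length + 1 := by
  induction st generalizing y acc with
  | nil => simp [backward]
  | cons p st ih =>
    obtain ⟨m, wm, wp⟩ := p
    have h1 := ih true (true :: acc)
    have h2 := ih y (y :: acc)
    have h3 := ih false (false :: acc)
    simp only [backward, cost_bind, cost_call, cost_ite, cost_lt, List.length_cons]
    split_ifs <;> omega

theorem binaryMin_cost_le (z : ℝ) (P : List Node) :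
    (binaryMin z P).cost ≤ 9 * P.length + 3 * (bpList P).length + 3 := by
  have h1 := forward_cost_le z 0 [] P
  have h2 := backward_cost_le false [] (forward z 0 [] P).val
  rw [forward_val_length] at h2
  simp only [binaryMin, cost_bind, cost_call]
  simp at h2
  omega

/-! ### Splitting a chain -/

theorem pieces_nil (z c : ℝ) (ys : List Bool) : pieces z c [] ys = ⟨[], 1⟩ := by
  cases ys <;> rfl

theorem pieces_nil_right (z c : ℝ) (P : List Node) : pieces z c P [] = ⟨[], 1⟩ := by
  cases P <;> rfl

/-- The node `v`, restricted to the side of the label `y` and with `c` added to its slope. -/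
noncomputable def restrictNode (z c : ℝ) (y : Bool) (v : Node) (wm wp : ℝ) : Node :=
  ⟨⟨(restrict z y v.g).val.left + c, (restrict z y v.g).val.bps⟩, wm, wp⟩

theorem pieces_val_singleton (z c : ℝ) (v : Node) (P : List Node) (y : Bool) :
    (pieces z c (v :: P) [y]).val = [(y, [restrictNode z c y v v.wm v.wp])] := by
  simp [pieces, restrictNode]

theorem pieces_val_same (z c : ℝ) (v : Node) (P : List Node) (y : Bool) (ys : List Bool) :
    (pieces z c (v :: P) (y :: y :: ys)).val =
      match (pieces z 0 P (y :: ys)).val with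
      | [] => []
      | (b, Q) :: Qs => (b, restrictNode z c y v v.wm v.wp :: Q) :: Qs := by
  simp only [pieces, val_bind, val_add, beq_self_eq_true, if_true]
  cases (pieces z 0 P (y :: ys)).val <;> simp [restrictNode]

theorem pieces_val_ne (z c : ℝ) (v : Node) (P : List Node) {y y' : Bool} (h : y ≠ y')
    (ys : List Bool) :
    (pieces z c (v :: P) (y :: y' :: ys)).val =
      (y, [restrictNode z (c - if y then v.wm else v.wp) y v 0 0]) ::
        (pieces z (if y then v.wm else v.wp) P (y' :: ys)).val := by
  have : (y == y') = false := by simpa using h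
  simp only [pieces, val_bind, val_add, this, restrictNode]
  simp [add_sub_assoc]

theorem pieces_cost_le (z c : ℝ) (P : List Node) (ys : List Bool) :
    (pieces z c P ys).cost ≤ 5 * P.length + 3 * (bpList P).length + 1 := by
  induction P generalizing c ys with
  | nil => simp [pieces_nil]
  | cons v P ih =>
    match ys with
    | [] => simp [pieces_nil_right]
    | [y] =>
      have := restrict_cost_le z y v.g
      simp only [pieces, cost_bind, cost_call, cost_add, cost_pure, List.length_cons, bpList_cons,
        List.length_append, List.length_map]
      omega
    | y :: y' :: ys =>
      have h1 := restrict_cost_le z y v.g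
      have h2 := ih 0 (y' :: ys)
      have h3 := ih v.wm (y' :: ys)
      have h4 := ih v.wp (y' :: ys)
      simp only [pieces, cost_bind, cost_call, cost_add, cost_ite, List.length_cons, bpList_cons,
        List.length_append, List.length_map, cost_sub, cost_pure]
      split_ifs
      · cases (pieces z 0 P (y' :: ys)).val <;> simp only [cost_pure] <;> omega
      · omega
      · omega

/-! ### Sizes of the subproblems and running time -/

/-- Number of entries of `L` on the side of the label `y` of the pivot `z`. -/
noncomputable def countSide (z : ℝ) (y : Bool) (L : List ℝ) : ℕ :=
  if y then countGT z L else countLT z L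

theorem countSide_append (z : ℝ) (y : Bool) (L M : List ℝ) :
    countSide z y (L ++ M) = countSide z y L + countSide z y M := by
  cases y <;> simp [countSide, countLT_append, countGT_append]

theorem countSide_le_length (z : ℝ) (y : Bool) (L : List ℝ) : countSide z y L ≤ L.length := by
  cases y <;> simp [countSide, countLT_le_length, countGT_le_length]

theorem restrictNode_bps (z c : ℝ) (y : Bool) (v : Node) (wm wp : ℝ) :
    (restrictNode z c y v wm wp).g.bps.length = countSide z y (v.g.bps.map Prod.fst) := by
  classical
  simp only [restrictNode, restrict_val_bps]
  cases y
  · simp [countSide, countLT, OnSide, ← List.countP_eq_length_filter, List.countP_map,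
      Function.comp_def]
  · simp [countSide, countGT, OnSide, ← List.countP_eq_length_filter, List.countP_map,
      Function.comp_def]

/-- The last clause serves the induction: a node is prepended to the first piece, and its remaining
breakpoints are counted on the right side only if that piece carries the node's own label.
Nonemptiness of the pieces lets their nodes pay for the overhead of the calls. -/
theorem pieces_size (z c : ℝ) (P : List Node) (ys : List Bool) :
    (((pieces z c P ys).val.map fun q => q.2.length).sum ≤ P.length ∧
      ((pieces z c P ys).val.map fun q => (bpList q.2).length).sum ≤ (bpList P).length) ∧
      (∀ q ∈ (pieces z c P ys).val, q.2 ≠ [] ∧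
        (bpList q.2).length ≤ countSide z q.1 (bpList P)) ∧
      ∀ b Q Qs, (pieces z c P ys).val = (b, Q) :: Qs → ys.head? = some b := by
  induction P generalizing c ys with
  | nil => simp [pieces_nil]
  | cons v P ih =>
    match ys with
    | [] => simp [pieces_nil_right]
    | [y] =>
      rw [pieces_val_singleton]
      have h1 := restrictNode_bps z c y v v.wm v.wp
      have h2 := countSide_le_length z y (v.g.bps.map Prod.fst)
      simp only [List.length_map] at h2
      refine ⟨⟨by simp, ?_⟩, ?_, ?_⟩
      · simp; omega
      · simp [countSide_append]; omega
      · simp only [List.cons.injEq, Prod.mk.injEq]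
        rintro b Q Qs ⟨⟨rfl, -⟩, -⟩
        rfl
    | y :: y' :: ys =>
      have h2 := countSide_le_length z y (v.g.bps.map Prod.fst)
      simp only [List.length_map] at h2
      by_cases hy : y = y'
      · subst hy
        rw [pieces_val_same]
        obtain ⟨⟨i1, i2⟩, i3, i4⟩ := ih 0 (y :: ys)
        have h1 := restrictNode_bps z c y v v.wm v.wp
        rcases hq : (pieces z 0 P (y :: ys)).val with _ | ⟨⟨b, Q⟩, Qs⟩
        · simp
        · obtain rfl : y = b := by simpa using i4 b Q Qs hq
          rw [hq] at i1 i2 i3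
          simp only [List.map_cons, List.sum_cons, List.forall_mem_cons] at i1 i2 i3
          refine ⟨⟨?_, ?_⟩, ?_, ?_⟩
          · simp only [List.map_cons, List.sum_cons, List.length_cons]; omega
          · simp only [List.map_cons, List.sum_cons, bpList_cons, List.length_append,
              List.length_map]
            omega
          · rw [List.forall_mem_cons]
            refine ⟨⟨by simp, ?_⟩, fun q hq => ⟨(i3.2 q hq).1, ?_⟩⟩
            · simp only [bpList_cons, countSide_append, List.length_append, List.length_map]
              have := i3.1.2
              omega
            · have := (i3.2 q hq).2
              simp only [bpList_cons, countSide_append]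
              omega
          · simp only [List.cons.injEq, Prod.mk.injEq]
            rintro b Q Qs ⟨⟨rfl, -⟩, -⟩
            rfl
      · rw [pieces_val_ne _ _ _ _ hy]
        obtain ⟨⟨i1, i2⟩, i3, -⟩ := ih (if y then v.wm else v.wp) (y' :: ys)
        have h1 := restrictNode_bps z (c - if y then v.wm else v.wp) y v 0 0
        refine ⟨⟨?_, ?_⟩, ?_, ?_⟩
        · simp only [List.map_cons, List.sum_cons, List.length_cons, List.length_nil]; omega
        · simp only [List.map_cons, List.sum_cons, bpList_cons, List.length_append,
            List.length_map, bpList_nil, List.length_nil]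
          omega
        · rw [List.forall_mem_cons]
          refine ⟨⟨by simp, ?_⟩, fun q hq => ⟨(i3 q hq).1, ?_⟩⟩
          · simp only [bpList_cons, countSide_append, List.length_append, List.length_map,
              bpList_nil, List.length_nil]
            omega
          · have := (i3 q hq).2
            simp only [bpList_cons, countSide_append]
            omega
        · simp only [List.cons.injEq, Prod.mk.injEq]
          rintro b Q Qs ⟨⟨rfl, -⟩, -⟩
          rfl

theorem fill_val (a : WithBot ℝ) (P : List Node) :
    (fill a P).val = List.replicate P.length a := by
  induction P with
  | nil => rfl
  | cons v P ih => simp [fill, ih, List.replicate_succ]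

theorem fill_cost (a : WithBot ℝ) (P : List Node) : (fill a P).cost = P.length + 1 := by
  induction P with
  | nil => rfl
  | cons v P ih => simp [fill, ih]; omega

theorem collect_val {α β : Type} (F : α → Timed (List β)) (Q : List α) :
    (collect F Q).val = (Q.map fun q => (F q).val).flatten := by
  induction Q with
  | nil => rfl
  | cons q Q ih => simp [collect, ih]

theorem collect_cost {α β : Type} (F : α → Timed (List β)) (Q : List α) :
    (collect F Q).cost = (Q.map fun q => (F q).cost + (F q).val.length + 2).sum + 1 := by
  induction Q with
  | nil => rfl
  | cons q Q ih => simp [collect, ih]; omega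

/-- One level of the recursion. -/
theorem solve_succ (fuel : ℕ) (a : WithBot ℝ) (P : List Node) :
    solve (fuel + 1) a P = (do
      call
      let L ← breakpoints P
      if bpList P = [] then fill a P
      else
        let z ← median L
        let y ← binaryMin z P
        let Qs ← pieces z 0 P y
        collect (fun Q => solve fuel (if Q.1 then (z : WithBot ℝ) else a) Q.2) Qs) := by
  have h := breakpoints_val P
  rw [solve]
  congr 1
  funext _
  simp only [bind]
  rw [h]
  cases bpList P <;> simp

theorem solve_val_length_le (fuel : ℕ) (a : WithBot ℝ) (P : List Node) :
    (solve fuel a P).val.length ≤ P.length := by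
  induction fuel generalizing a P with
  | zero => simp [solve]
  | succ fuel ih =>
    rw [solve_succ]
    simp only [val_bind, val_ite, fill_val]
    split_ifs with h
    · simp
    · rw [collect_val, List.length_flatten, List.map_map]
      exact (List.sum_le_sum fun q _ => ih _ _).trans (pieces_size _ 0 P _).1.1

/-- For the upper median both strict sides have at most half of the entries, however often the
median itself is repeated. -/
theorem countSide_median_le {L : List ℝ} (hL : L ≠ []) (y : Bool) :
    countSide (median L).val y L ≤ L.length / 2 := by
  obtain ⟨-, h1, h2⟩ := median_val hL
  cases y <;> simp [countSide] <;> omega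

theorem size_div_two_add_one {T : ℕ} (h : T ≠ 0) : (T / 2).size + 1 ≤ T.size := by
  have h1 : T / 2 < 2 ^ (T.size - 1) := by
    have := Nat.lt_size_self T
    have h3 : T.size ≠ 0 := by simpa [Nat.size_eq_zero] using h
    obtain ⟨s, hs⟩ := Nat.exists_eq_succ_of_ne_zero h3
    rw [hs, Nat.pow_succ] at this
    rw [hs, Nat.succ_sub_one]
    omega
  have h2 := Nat.size_le.2 h1
  have h3 : T.size ≠ 0 := by simpa [Nat.size_eq_zero] using h
  omega

/-- The factor `size + 1` counts the levels; the extra one is for a chain without breakpoints. Each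
level is paid for by `2000 * (nodes + breakpoints)`, most of which is the cost of selection. -/
theorem solve_cost_le (fuel : ℕ) (a : WithBot ℝ) (P : List Node) (hP : P ≠ []) :
    (solve fuel a P).cost ≤
      2000 * (P.length + (bpList P).length) * ((bpList P).length.size + 1) := by
  induction fuel generalizing a P with
  | zero => simp [solve]
  | succ fuel ih =>
    have hP1 := List.length_pos_iff.2 hP
    rw [solve_succ]
    simp only [cost_bind, cost_ite, fill_cost, breakpoints_val, breakpoints_cost, cost_call,
      collect_cost]
    split_ifs with h
    · simp [h]; omega
    · have hT := List.length_pos_iff.2 h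
      have h1 := median_cost_le (bpList P)
      have hs := countSide_median_le h
      generalize (median (bpList P)).val = z at *
      have h2 := binaryMin_cost_le z P
      generalize (binaryMin z P).val = y at *
      have h3 := pieces_cost_le z 0 P y
      obtain ⟨⟨p1, p2⟩, p3, -⟩ := pieces_size z 0 P y
      generalize (pieces z 0 P y).val = Qs at *
      have h4 : (Qs.map fun q => (solve fuel (if q.1 then (z : WithBot ℝ) else a) q.2).cost +
          (solve fuel (if q.1 then (z : WithBot ℝ) else a) q.2).val.length + 2).sum ≤
          2000 * (P.length + (bpList P).length) * (bpList P).length.size + 3 * P.length := by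
        -- Copying the output of a piece and the overhead 2 cost at most three steps per node, as
        -- the piece is nonempty. Halving the breakpoints removes one from the level count.
        calc _ ≤ (Qs.map fun q => 2000 * (bpList P).length.size *
              (q.2.length + (bpList q.2).length) + 3 * q.2.length).sum := by
              refine List.sum_le_sum fun q hq => ?_
              obtain ⟨q1, q2⟩ := p3 q hq
              have e1 := ih (if q.1 then (z : WithBot ℝ) else a) q.2 q1
              have e2 := solve_val_length_le fuel (if q.1 then (z : WithBot ℝ) else a) q.2
              have e3 := List.length_pos_iff.2 q1
              have e4 : (bpList q.2).length.size + 1 ≤ (bpList P).length.size :=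
                (Nat.add_le_add_right (Nat.size_le_size (q2.trans (hs q.1))) 1).trans
                  (size_div_two_add_one hT.ne')
              have e5 : 2000 * (q.2.length + (bpList q.2).length) *
                  ((bpList q.2).length.size + 1) ≤
                  2000 * (bpList P).length.size * (q.2.length + (bpList q.2).length) := by
                rw [mul_right_comm]
                gcongr
              omega
          _ = 2000 * (bpList P).length.size * ((Qs.map fun q => q.2.length).sum +
                (Qs.map fun q => (bpList q.2).length).sum) +
                3 * (Qs.map fun q => q.2.length).sum := by
              rw [List.sum_map_add, List.sum_map_mul_left, List.sum_map_mul_left,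
                List.sum_map_add]
          _ ≤ 2000 * (bpList P).length.size * (P.length + (bpList P).length) +
                3 * P.length := by gcongr
          _ = _ := by ring
      rw [mul_add _ _ 1]
      generalize 2000 * (P.length + (bpList P).length) * (bpList P).length.size = X at *
      omega

theorem minimize_cost_le (P : List Node) (hP : P ≠ []) :
    (minimize P).cost ≤
      2010 * (P.length + (bpList P).length) * ((bpList P).length.size + 1) := by
  have h1 := solve_cost_le ((bpList P).length + 1) ⊥ P hP
  have h2 := List.length_pos_iff.2 hP
  simp only [minimize, cost_bind, breakpoints_cost, length_cost, cost_call, cost_add,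
    length_val, val_add, breakpoints_val]
  have h3 : 10 * (P.length + (bpList P).length) ≤
      10 * (P.length + (bpList P).length) * ((bpList P).length.size + 1) :=
    Nat.le_mul_of_pos_right _ (by omega)
  have h4 : 2010 * (P.length + (bpList P).length) * ((bpList P).length.size + 1) =
    2000 * (P.length + (bpList P).length) * ((bpList P).length.size + 1) +
    10 * (P.length + (bpList P).length) * ((bpList P).length.size + 1) := by ring
  omega

/-! ### Correctness of the recursion -/

open Classical in
/-- Whether `v` is at least `t`. -/
noncomputable def atLeast (t : ℝ) (v : WithBot ℝ) : Bool := decide ((t : WithBot ℝ) ≤ v)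

theorem atLeast_eq_true {t : ℝ} {v : WithBot ℝ} : atLeast t v = true ↔ (t : WithBot ℝ) ≤ v := by
  simp [atLeast]

theorem atLeast_eq_false {t : ℝ} {v : WithBot ℝ} : atLeast t v = false ↔ v < (t : WithBot ℝ) := by
  simp [atLeast]

/-- The real numbers of the interval `(a, b]`. -/
def window (a : WithBot ℝ) (b : ℝ) : Set ℝ := {t | a < (t : WithBot ℝ) ∧ t ≤ b}

/-- The vector `x` is determined by the labels of the binary problems at all values in `(a, b]`, if
the chain `P` receives the message `M t` at the value `t`. -/
structure IsSolution (a : WithBot ℝ) (b : ℝ) (P : List Node) (x : List (WithBot ℝ)) (M : ℝ → ℝ) :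
    Prop where
  bps : ∀ r ∈ bpList P, a < (r : WithBot ℝ) ∧ r < b
  weights : ∀ v ∈ P, v.wm ≤ v.wp
  mono : ∀ v ∈ P, MonotoneOn v.g.eval (window a b)
  range : ∀ w ∈ x, a ≤ w ∧ w < (b : WithBot ℝ)
  labels_eq : ∀ t ∈ window a b, labels t (M t) P = x.map (atLeast t)

/-- The lower end of the interval of the subproblem with label `y`. -/
noncomputable def lower (a : WithBot ℝ) (z : ℝ) (y : Bool) : WithBot ℝ :=
  if y then (z : WithBot ℝ) else a

/-- The upper end of the interval of the subproblem with label `y`. -/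
noncomputable def upper (b z : ℝ) (y : Bool) : ℝ := if y then b else z

theorem window_subset {a : WithBot ℝ} {b z : ℝ} (hz : z ∈ window a b) (y : Bool) :
    window (lower a z y) (upper b z y) ⊆ window a b := by
  rintro t ⟨h1, h2⟩
  cases y
  · exact ⟨h1, le_trans h2 hz.2⟩
  · exact ⟨hz.1.trans h1, h2⟩

theorem restrict_val_eval {a : WithBot ℝ} {b z t : ℝ} {y : Bool} (h : StepFn)
    (ht : t ∈ window (lower a z y) (upper b z y)) : (restrict z y h).val.eval t = h.eval t := by
  cases y
  · exact restrict_val_eval_false h ht.2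
  · exact restrict_val_eval_true h (WithBot.coe_lt_coe.1 ht.1)

theorem restrictNode_eval {a : WithBot ℝ} {b z t : ℝ} {y : Bool} (c : ℝ) (v : Node) (wm wp : ℝ)
    (ht : t ∈ window (lower a z y) (upper b z y)) :
    (restrictNode z c y v wm wp).g.eval t = v.g.eval t + c := by
  rw [restrictNode, eval_add_left]
  exact congrArg (· + c) (restrict_val_eval v.g ht)

theorem label_false_right {m wm wp : ℝ} : label m wm wp false = true ↔ m < wm := by
  simp [label]

theorem label_true_right {m wm wp : ℝ} (h : wm ≤ wp) : label m wm wp true = true ↔ m < wp := by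
  simp only [label]
  simpa using fun h1 => h.trans_lt' h1

theorem proj_of_lt {lo hi v : ℝ} (h : v < lo) : proj lo hi v = lo := if_pos h

theorem proj_of_ge {lo hi v : ℝ} (h : lo ≤ hi) (hv : hi ≤ v) : proj lo hi v = hi := by
  rw [proj, if_neg (h.trans hv).not_gt]
  split_ifs with h1
  · rfl
  · exact le_antisymm (not_lt.1 h1) hv

/-- Prepending a restricted node to a solution of a subproblem. -/
theorem IsSolution.cons {a : WithBot ℝ} {b z : ℝ} (hz : z ∈ window a b) {v : Node}
    (hbps : ∀ r ∈ bpList [v], a < (r : WithBot ℝ) ∧ r < b)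
    (hmono : MonotoneOn v.g.eval (window a b))
    {x₀ : WithBot ℝ} (hx : a ≤ x₀ ∧ x₀ < (b : WithBot ℝ)) {y : Bool} (hy : atLeast z x₀ = y)
    {c wm wp : ℝ} (hw : wm ≤ wp) {Q : List Node} {x : List (WithBot ℝ)} {M M' : ℝ → ℝ}
    (hQ : IsSolution (lower a z y) (upper b z y) Q x M)
    (hM : ∀ t ∈ window (lower a z y) (upper b z y), proj wm wp (v.g.eval t + c + M' t) = M t)
    (hl : ∀ t ∈ window (lower a z y) (upper b z y),
      label (v.g.eval t + c + M' t) wm wp ((x.map (atLeast t)).headD false) = atLeast t x₀) :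
    IsSolution (lower a z y) (upper b z y) (restrictNode z c y v wm wp :: Q) (x₀ :: x) M' := by
  classical
  constructor
  · intro r hr
    rw [bpList_cons, List.mem_append] at hr
    rcases hr with hr | hr
    · simp only [restrictNode, restrict_val_bps, List.mem_map, List.mem_filter,
        decide_eq_true_eq] at hr
      obtain ⟨p, ⟨hp, hs⟩, rfl⟩ := hr
      have := hbps p.1 (by simp [bpList]; exact ⟨_, hp⟩)
      cases y
      · exact ⟨this.1, hs⟩
      · exact ⟨WithBot.coe_lt_coe.2 hs, this.2⟩
    · exact hQ.bps r hr
  · exact List.forall_mem_cons.2 ⟨hw, hQ.weights⟩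
  · refine List.forall_mem_cons.2 ⟨fun s hs t ht hst => ?_, hQ.mono⟩
    rw [restrictNode_eval c v wm wp hs, restrictNode_eval c v wm wp ht]
    exact add_le_add_left (hmono (window_subset hz y hs) (window_subset hz y ht) hst) c
  · refine List.forall_mem_cons.2 ⟨?_, hQ.range⟩
    cases y
    · exact ⟨hx.1, atLeast_eq_false.1 hy⟩
    · exact ⟨atLeast_eq_true.1 hy, hx.2⟩
  · intro t ht
    have e : (restrictNode z c y v wm wp).wm = wm ∧ (restrictNode z c y v wm wp).wp = wp :=
      ⟨rfl, rfl⟩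
    rw [labels, restrictNode_eval c v wm wp ht, e.1, e.2, hM t ht, hQ.labels_eq t ht, hl t ht,
      List.map_cons]

theorem IsSolution.nil (a : WithBot ℝ) (b : ℝ) (M : ℝ → ℝ) : IsSolution a b [] [] M := by
  constructor <;> simp [labels]

/-- `M` is the true message into the first node, and `M'` is what its piece sees after the constant
`c` has been moved into the slope. Inside a piece `M' = M` and `c = 0`; at the start of a later
piece `M' = 0` and `c` is the constant message over the edge that was cut. -/
theorem isSolution_pieces {a : WithBot ℝ} {b z : ℝ} (hz : z ∈ window a b) (P : List Node)
    (x₀ : WithBot ℝ) (x : List (WithBot ℝ)) (M M' : ℝ → ℝ) (c : ℝ) (y : Bool)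
    (hP : IsSolution a b P (x₀ :: x) M) (hM : MonotoneOn M (window a b))
    (hy : atLeast z x₀ = y)
    (hc : ∀ t ∈ window (lower a z y) (upper b z y), M t = M' t + c) :
    ∃ Q Qs x' xs, (pieces z c P ((x₀ :: x).map (atLeast z))).val = (y, Q) :: Qs ∧
      x₀ :: x = (x₀ :: x') ++ xs.flatten ∧
      IsSolution (lower a z y) (upper b z y) Q (x₀ :: x') M' ∧
      List.Forall₂ (fun q w =>
        IsSolution (lower a z q.1) (upper b z q.1) q.2 w fun _ => 0) Qs xs := by
  induction P generalizing x₀ x M M' c y with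
  | nil => simpa [labels] using hP.labels_eq z hz
  | cons v P ih =>
    have hw : v.wm ≤ v.wp := hP.weights v List.mem_cons_self
    have hmono : MonotoneOn v.g.eval (window a b) := hP.mono v List.mem_cons_self
    have hbps : ∀ r ∈ bpList [v], a < (r : WithBot ℝ) ∧ r < b := fun r hr =>
      hP.bps r (by simp only [bpList_cons, bpList_nil, List.append_nil] at hr
                   rw [bpList_cons]; exact List.mem_append_left _ hr)
    have hx := hP.range x₀ List.mem_cons_self
    have hlab : ∀ t ∈ window a b, label (v.g.eval t + M t) v.wm v.wp
          ((x.map (atLeast t)).headD false) = atLeast t x₀ ∧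
        labels t (proj v.wm v.wp (v.g.eval t + M t)) P = x.map (atLeast t) := fun t ht => by
      have := hP.labels_eq t ht
      rw [labels, List.map_cons, List.cons.injEq] at this
      exact ⟨by rw [← this.2]; exact this.1, this.2⟩
    have hsum : MonotoneOn (fun t => v.g.eval t + M t) (window a b) := hmono.add hM
    have hP' : IsSolution a b P x fun t => proj v.wm v.wp (v.g.eval t + M t) :=
      { bps := fun r hr => hP.bps r (by rw [bpList_cons]; exact List.mem_append_right _ hr)
        weights := fun w hw => hP.weights w (List.mem_cons_of_mem _ hw)
        mono := fun w hw => hP.mono w (List.mem_cons_of_mem _ hw)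
        range := fun w hw => hP.range w (List.mem_cons_of_mem _ hw)
        labels_eq := fun t ht => (hlab t ht).2 }
    have hM1 : MonotoneOn (fun t => proj v.wm v.wp (v.g.eval t + M t)) (window a b) :=
      fun s hs t ht hst => proj_mono hw (hsum hs ht hst)
    have hc' : ∀ t ∈ window (lower a z y) (upper b z y),
        v.g.eval t + c + M' t = v.g.eval t + M t := fun t ht => by rw [hc t ht]; ring
    cases x with
    | nil =>
      refine ⟨[restrictNode z c y v v.wm v.wp], [], [], [], ?_, rfl, ?_, List.Forall₂.nil⟩
      · rw [List.map_cons, List.map_nil, pieces_val_singleton, hy]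
      · refine IsSolution.cons hz hbps hmono hx hy hw (IsSolution.nil _ _ _) (fun t ht => rfl)
          fun t ht => ?_
        rw [hc' t ht]
        exact (hlab t (window_subset hz y ht)).1
    | cons x₁ x =>
      by_cases hyy : atLeast z x₁ = y
      · obtain ⟨Q, Qs, x', xs, e1, e2, e3, e4⟩ := ih x₁ x _
          (fun t => proj v.wm v.wp (v.g.eval t + M t)) 0 y hP' hM1 hyy (fun t _ => (add_zero _).symm)
        refine ⟨restrictNode z c y v v.wm v.wp :: Q, Qs, x₁ :: x', xs, ?_, by rw [e2]; rfl, ?_, e4⟩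
        · rw [List.map_cons, hyy] at e1
          rw [List.map_cons, List.map_cons, hy, hyy, pieces_val_same, e1]
        · refine IsSolution.cons hz hbps hmono hx hy hw e3 (fun t ht => by rw [hc' t ht])
            fun t ht => ?_
          rw [hc' t ht]
          exact (hlab t (window_subset hz y ht)).1
      · have hlz := (hlab z hz).1
        rw [hy, List.map_cons, List.headD_cons] at hlz
        -- The edge is cut. For labels 0, 1 the message sum at `z` is at least `wp`, and by
        -- monotonicity it stays so for `t > z`; for labels 1, 0 it is below `wm` at `z` and for all
        -- `t ≤ z`. So the projection is constant where the next piece lives.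
        obtain ⟨Q, Qs, x', xs, e1, e2, e3, e4⟩ := ih x₁ x _ (fun _ => 0)
          (if y then v.wm else v.wp) (atLeast z x₁) hP' hM1 rfl (fun t ht => by
            have ht' := window_subset hz _ ht
            cases y
            · have h1 : atLeast z x₁ = true := by simpa using hyy
              rw [h1] at ht hlz
              have h2 := hsum hz ht' (WithBot.coe_lt_coe.1 ht.1).le
              have h3 : v.wp ≤ v.g.eval z + M z := by
                rw [← not_lt, ← label_true_right hw]
                exact fun h => Bool.false_ne_true (hlz.symm.trans h)
              simpa using proj_of_ge hw (h3.trans h2)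
            · have h1 : atLeast z x₁ = false := by simpa using hyy
              rw [h1] at ht hlz
              have h2 := hsum ht' hz ht.2
              simpa using proj_of_lt (h2.trans_lt (label_false_right.1 hlz)))
        refine ⟨[restrictNode z (c - if y then v.wm else v.wp) y v 0 0],
          (atLeast z x₁, Q) :: Qs, [], (x₁ :: x') :: xs, ?_, by rw [e2]; rfl, ?_,
          List.Forall₂.cons e3 e4⟩
        · rw [List.map_cons] at e1
          rw [List.map_cons, List.map_cons, hy, pieces_val_ne _ _ _ _ (Ne.symm hyy), e1]
        · refine IsSolution.cons hz hbps hmono hx hy le_rfl (IsSolution.nil _ _ _) (fun t ht => rfl)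
            fun t ht => ?_
          -- On the window of the left piece the next label is constantly the one opposite to `y`.
          -- The rule for the label is then a single comparison with `wp` or `wm`, that is, a
          -- comparison with zero after subtracting this weight.
          have h1 := (hlab t (window_subset hz y ht)).1
          have h2 : v.g.eval t + (c - if y then v.wm else v.wp) + M' t =
            v.g.eval t + M t - if y then v.wm else v.wp := by rw [hc t ht]; ring
          rw [h2, ← h1]
          rw [List.map_cons, List.headD_cons]
          cases y
          · have h3 : atLeast z x₁ = true := by simpa using hyy
            have h4 : atLeast t x₁ = true := atLeast_eq_true.2
              ((WithBot.coe_le_coe.2 ht.2).trans (atLeast_eq_true.1 h3))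
            rw [h4]
            rw [Bool.eq_iff_iff, label_true_right hw]
            simp [label]
          · have h3 : atLeast z x₁ = false := by simpa using hyy
            have h4 : atLeast t x₁ = false := atLeast_eq_false.2
              ((atLeast_eq_false.1 h3).trans ht.1)
            rw [h4]
            rw [Bool.eq_iff_iff, label_false_right]
            simp [label]

theorem labels_length (z m : ℝ) (P : List Node) : (labels z m P).length = P.length := by
  induction P generalizing m with
  | nil => rfl
  | cons v P ih => simp [labels, ih]

theorem labels_congr {s t : ℝ} (m : ℝ) {P : List Node} (h : ∀ v ∈ P, v.g.eval s = v.g.eval t) :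
    labels s m P = labels t m P := by
  induction P generalizing m with
  | nil => rfl
  | cons v P ih =>
    rw [labels, labels, h v List.mem_cons_self,
      ih _ fun w hw => h w (List.mem_cons_of_mem _ hw)]

/-- The algorithm never uses `b`; the proof needs a finite `b` above all coordinates, at which every
label is 0. -/
theorem solve_val (fuel : ℕ) (a : WithBot ℝ) (b : ℝ) (hab : a < (b : WithBot ℝ)) (P : List Node)
    (x : List (WithBot ℝ)) (hf : (bpList P).length < fuel) (h : IsSolution a b P x fun _ => 0) :
    (solve fuel a P).val = x := by
  induction fuel generalizing a b P x with
  | zero => omega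
  | succ fuel ih =>
    have hb : b ∈ window a b := ⟨hab, le_rfl⟩
    have hlen : P.length = x.length := by
      have := congrArg List.length (h.labels_eq b hb)
      rwa [labels_length, List.length_map] at this
    rw [solve_succ]
    simp only [val_bind, val_ite, fill_val, breakpoints_val, collect_val, binaryMin_val]
    split_ifs with h0
    · rw [hlen, eq_comm, List.eq_replicate_iff]
      refine ⟨rfl, fun w hw => le_antisymm (not_lt.1 fun haw => ?_) (h.range w hw).1⟩
      -- A coordinate `t > a` would have label 1 at the value `t`, hence also at `b`, since without
      -- breakpoints the labels are constant; but `t < b`.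
      obtain ⟨t, rfl⟩ := WithBot.ne_bot_iff_exists.1 (ne_bot_of_gt haw)
      have ht : t ∈ window a b := ⟨haw, (WithBot.coe_lt_coe.1 (h.range _ hw).2).le⟩
      have e : labels t 0 P = labels b 0 P := labels_congr 0 fun v hv => eval_eq_of_forall
        fun p hp => by
          have : p.1 ∈ bpList P := List.mem_flatMap.2 ⟨v, hv, List.mem_map.2 ⟨p, hp, rfl⟩⟩
          simp [h0] at this
      rw [h.labels_eq t ht, h.labels_eq b hb, List.map_inj_left] at e
      have := e _ hw
      rw [atLeast_eq_true.2 le_rfl, eq_comm, atLeast_eq_true] at this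
      exact absurd (h.range _ hw).2 (not_lt.2 this)
    · have hm := (median_val h0).1
      have hs := countSide_median_le h0
      have hT := List.length_pos_iff.2 h0
      generalize (median (bpList P)).val = z at *
      have hz : z ∈ window a b := ⟨(h.bps z hm).1, (h.bps z hm).2.le⟩
      rw [h.labels_eq z hz]
      cases x with
      | nil =>
        rw [List.length_nil, List.length_eq_zero_iff] at hlen
        exact absurd (by rw [hlen]; rfl) h0
      | cons x₀ x =>
        have hsz := (pieces_size z 0 P ((x₀ :: x).map (atLeast z))).2.1
        obtain ⟨Q, Qs, x', xs, e1, e2, e3, e4⟩ := isSolution_pieces hz P x₀ x (fun _ => 0)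
          (fun _ => 0) 0 _ h (fun _ _ _ _ _ => le_rfl) rfl (fun _ _ => by simp)
        rw [e1] at hsz ⊢
        have e5 : List.Forall₂ (fun q w =>
            IsSolution (lower a z q.1) (upper b z q.1) q.2 w fun _ => 0)
            ((atLeast z x₀, Q) :: Qs) ((x₀ :: x') :: xs) := List.Forall₂.cons e3 e4
        have e6 : x₀ :: x = ((x₀ :: x') :: xs).flatten := by rw [e2]; rfl
        rw [e6]
        congr 1
        generalize (atLeast z x₀, Q) :: Qs = R at *
        generalize (x₀ :: x') :: xs = X at *
        clear e6 e2 e1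
        induction e5 with
        | nil => rfl
        | @cons q w R X hqw _ ih2 =>
          rw [List.forall_mem_cons] at hsz
          rw [List.map_cons, ih2 hsz.2]
          congr 1
          refine ih (lower a z q.1) (upper b z q.1) ?_ q.2 w ?_ hqw
          · cases q.1
            · exact hz.1
            · exact WithBot.coe_lt_coe.2 (h.bps z hm).2
          · have := hsz.1.2.trans (hs q.1)
            omega

/-! ### Optimality conditions -/

/-- The left derivative is a subgradient: it is the limit of the slopes from the left, and slopes of
a convex function are monotone. -/
theorem _root_.ConvexOn.add_mul_le_of_hasDerivWithinAt_Iic {f : ℝ → ℝ}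
    (hf : ConvexOn ℝ Set.univ f) {G s : ℝ} (h : HasDerivWithinAt f G (Set.Iic s) s) (x : ℝ) :
    f s + G * (x - s) ≤ f x := by
  have h' : HasDerivWithinAt f G (Set.Iio s) s := h.mono Set.Iio_subset_Iic_self
  have ht := (hasDerivWithinAt_iff_tendsto_slope' (by simp)).1 h'
  rcases lt_trichotomy x s with hx | rfl | hx
  · have h1 : slope f s x ≤ G := by
      refine ge_of_tendsto ht ?_
      filter_upwards [Ioo_mem_nhdsLT hx] with w hw
      exact hf.slope_mono (Set.mem_univ s) ⟨Set.mem_univ _, hx.ne⟩ ⟨Set.mem_univ _, hw.2.ne⟩ hw.1.le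
    rw [slope_def_field, div_le_iff_of_neg (by linarith)] at h1
    linarith
  · simp
  · have h1 : G ≤ slope f s x := by
      refine le_of_tendsto ht ?_
      filter_upwards [self_mem_nhdsWithin] with w hw
      have hw : w < s := hw
      exact hf.slope_mono (Set.mem_univ s) ⟨Set.mem_univ _, hw.ne⟩ ⟨Set.mem_univ _, hx.ne'⟩
        (hw.trans hx).le
    rw [slope_def_field, le_div_iff₀ (by linarith)] at h1
    linarith

theorem StepFn.IsLeftDerivOf.monotone {h : StepFn} {f : ℝ → ℝ} (hf : ConvexOn ℝ Set.univ f)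
    (hh : h.IsLeftDerivOf f) : Monotone h.eval := by
  intro s t hst
  rcases hst.eq_or_lt with rfl | hst
  · exact le_rfl
  -- Adding the two subgradient inequalities gives `(h.eval s - h.eval t) * (t - s) ≤ 0`.
  have h1 := hf.add_mul_le_of_hasDerivWithinAt_Iic (hh s) t
  have h2 := hf.add_mul_le_of_hasDerivWithinAt_Iic (hh t) s
  by_contra hlt
  nlinarith [not_le.1 hlt]

theorem pairTerm_sub_le_of_le {wm wp d d' : ℝ} (hw : wm ≤ wp) (h : d' ≤ d) :
    pairTerm wm wp d' - pairTerm wm wp d ≤ wm * (d' - d) := by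
  simp only [pairTerm]
  split_ifs <;> nlinarith

theorem pairTerm_sub_le_of_ge {wm wp d d' : ℝ} (hw : wm ≤ wp) (h : d ≤ d') :
    pairTerm wm wp d' - pairTerm wm wp d ≤ wp * (d' - d) := by
  simp only [pairTerm]
  split_ifs <;> nlinarith

theorem pairTerm_sub_le_of_between {wm wp m d d' : ℝ} (h1 : wm ≤ m) (h2 : m ≤ wp)
    (h : 0 ≤ d' ∧ d' ≤ d ∨ d ≤ d' ∧ d' ≤ 0) :
    pairTerm wm wp d' - pairTerm wm wp d ≤ m * (d' - d) := by
  simp only [pairTerm]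
  split_ifs <;> rcases h with h | h <;> nlinarith

theorem le_proj {lo hi : ℝ} (h : lo ≤ hi) (v : ℝ) : lo ≤ proj lo hi v := by
  simp only [proj]; split_ifs <;> linarith

theorem proj_le {lo hi : ℝ} (h : lo ≤ hi) (v : ℝ) : proj lo hi v ≤ hi := by
  simp only [proj]; split_ifs <;> linarith

/-- The messages `μ` and the labels `y` of the dynamic program with unary slopes `G`. -/
structure IsDP {N : ℕ} (G : Fin (N + 1) → ℝ) (wm wp : Fin N → ℝ) (μ : ℕ → ℝ)
    (y : Fin (N + 1) → Bool) : Prop where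
  zero : μ 0 = 0
  last : μ (N + 1) = 0
  step : ∀ e : Fin N, μ (e + 1) = proj (wm e) (wp e) (G e.castSucc + μ e)
  label_last : y (Fin.last N) = label (G (Fin.last N) + μ N) 0 0 false
  label_step : ∀ e : Fin N,
    y e.castSucc = label (G e.castSucc + μ e) (wm e) (wp e) (y e.succ)

section Optimality

variable {N : ℕ} {G : Fin (N + 1) → ℝ} {wm wp : Fin N → ℝ} {μ : ℕ → ℝ} {y : Fin (N + 1) → Bool}

/-- The residual is the message sum minus its projection to `[wm, wp]`. It is positive only for a
message sum above `wp`, where the label is 0. -/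
theorem IsDP.residual_nonpos (h : IsDP G wm wp μ y) (hw : ∀ e, wm e ≤ wp e) {i : Fin (N + 1)}
    (hi : y i = true) : G i + μ i - μ (i + 1) ≤ 0 := by
  induction i using Fin.lastCases with
  | last =>
    rw [h.label_last, label_false_right] at hi
    simp only [Fin.val_last, h.last]
    linarith
  | cast e =>
    have h1 := h.step e
    rw [h.label_step] at hi
    simp only [Fin.val_castSucc, h1]
    simp only [label] at hi
    simp only [proj]
    have := hw e
    split_ifs at hi ⊢ <;> linarith

theorem IsDP.residual_nonneg (h : IsDP G wm wp μ y) (hw : ∀ e, wm e ≤ wp e) {i : Fin (N + 1)}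
    (hi : y i = false) : 0 ≤ G i + μ i - μ (i + 1) := by
  induction i using Fin.lastCases with
  | last =>
    rw [h.label_last, ← Bool.not_eq_true, label_false_right] at hi
    simp only [Fin.val_last, h.last]
    linarith
  | cast e =>
    have h1 := h.step e
    rw [h.label_step] at hi
    simp only [Fin.val_castSucc, h1]
    simp only [label] at hi
    simp only [proj]
    have := hw e
    split_ifs at hi ⊢ <;> linarith

theorem IsDP.message_true_false (h : IsDP G wm wp μ y) {e : Fin N}
    (h1 : y e.castSucc = true) (h2 : y e.succ = false) : μ (e + 1) = wm e := by
  rw [h.label_step, h2, label_false_right] at h1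
  rw [h.step, proj_of_lt h1]

theorem IsDP.message_false_true (h : IsDP G wm wp μ y) (hw : ∀ e, wm e ≤ wp e) {e : Fin N}
    (h1 : y e.castSucc = false) (h2 : y e.succ = true) : μ (e + 1) = wp e := by
  rw [h.label_step, h2, ← Bool.not_eq_true, label_true_right (hw e), not_lt] at h1
  rw [h.step, proj_of_ge (hw e) h1]

/-- The edge terms grow at most as predicted by the messages, if every difference moves towards the
direction that the labels indicate. -/
theorem IsDP.edge_le (h : IsDP G wm wp μ y) (hw : ∀ e, wm e ≤ wp e) (e : Fin N) {d d' : ℝ}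
    (h11 : y e.castSucc = y e.succ → 0 ≤ d' ∧ d' ≤ d ∨ d ≤ d' ∧ d' ≤ 0 ∨ d' = d)
    (h10 : y e.castSucc = true → y e.succ = false → d' ≤ d)
    (h01 : y e.castSucc = false → y e.succ = true → d ≤ d') :
    pairTerm (wm e) (wp e) d' - pairTerm (wm e) (wp e) d ≤ μ (e + 1) * (d' - d) := by
  by_cases hy : y e.castSucc = y e.succ
  · rcases h11 hy with hd | hd | rfl
    · exact pairTerm_sub_le_of_between (h.step e ▸ le_proj (hw e) _) (h.step e ▸ proj_le (hw e) _)
        (Or.inl hd)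
    · exact pairTerm_sub_le_of_between (h.step e ▸ le_proj (hw e) _) (h.step e ▸ proj_le (hw e) _)
        (Or.inr hd)
    · simp
  · rcases h1 : y e.castSucc with _ | _ <;> rcases h2 : y e.succ with _ | _
    · exact absurd (h1.trans h2.symm) hy
    · rw [h.message_false_true hw h1 h2]
      exact pairTerm_sub_le_of_ge (hw e) (h01 h1 h2)
    · rw [h.message_true_false h1 h2]
      exact pairTerm_sub_le_of_le (hw e) (h10 h1 h2)
    · exact absurd (h1.trans h2.symm) hy

/-- Summation by parts; the boundary terms vanish because the messages at both ends are zero. -/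
theorem IsDP.sum_eq (h : IsDP G wm wp μ y) (u : Fin (N + 1) → ℝ) :
    ∑ i, G i * u i + ∑ e : Fin N, μ (e + 1) * (u e.succ - u e.castSucc) =
      ∑ i : Fin (N + 1), (G i + μ i - μ (i + 1)) * u i := by
  have h1 : ∑ i : Fin (N + 1), μ i * u i = ∑ e : Fin N, μ (e + 1) * u e.succ := by
    rw [Fin.sum_univ_succ]
    simp [h.zero]
  have h2 : ∑ i : Fin (N + 1), μ (i + 1) * u i = ∑ e : Fin N, μ (e + 1) * u e.castSucc := by
    rw [Fin.sum_univ_castSucc]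
    simp [h.last]
  simp only [mul_sub, sub_mul, add_mul, Finset.sum_sub_distrib, Finset.sum_add_distrib, h1, h2]
  ring

variable {f : Fin (N + 1) → ℝ → ℝ}

/-- The vector `x`, with the coordinates of label `1` raised to `t` at least. -/
noncomputable def raise (t : ℝ) (y : Fin (N + 1) → Bool) (x : Fin (N + 1) → ℝ) :
    Fin (N + 1) → ℝ := fun i => if y i then max (x i) t else x i

/-- The vector `x`, with the coordinates of label `0` lowered to `t` at most. -/
noncomputable def cut (t : ℝ) (y : Fin (N + 1) → Bool) (x : Fin (N + 1) → ℝ) :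
    Fin (N + 1) → ℝ := fun i => if y i then x i else min (x i) t

theorem IsDP.objective_sub_le (h : IsDP G wm wp μ y) {x x' : Fin (N + 1) → ℝ}
    (hf : ∀ i, f i (x' i) - f i (x i) ≤ G i * (x' i - x i)) :
    objective f wm wp x' - objective f wm wp x ≤
      ∑ i : Fin (N + 1), (G i + μ i - μ (i + 1)) * (x' i - x i) +
      ∑ e : Fin N, (pairTerm (wm e) (wp e) (x' e.succ - x' e.castSucc) -
        pairTerm (wm e) (wp e) (x e.succ - x e.castSucc) -
        μ (e + 1) * ((x' e.succ - x' e.castSucc) - (x e.succ - x e.castSucc))) := by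
  have h1 := h.sum_eq fun i => x' i - x i
  have h2 := Finset.sum_le_sum fun i (_ : i ∈ Finset.univ) => hf i
  have h3 : ∑ e : Fin N, μ (e + 1) * ((x' e.succ - x' e.castSucc) - (x e.succ - x e.castSucc)) =
      ∑ e : Fin N, μ (e + 1) * ((x' e.succ - x e.succ) - (x' e.castSucc - x e.castSucc)) :=
    Finset.sum_congr rfl fun e _ => by ring
  simp only [objective, Finset.sum_sub_distrib] at *
  linarith

theorem IsDP.le_of_label_false (h : IsDP G wm wp μ y) (hw : ∀ e, wm e ≤ wp e) {t : ℝ}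
    (hf : ∀ i w, f i t + G i * (w - t) ≤ f i w) {x : Fin (N + 1) → ℝ}
    (hx : IsLeast {x' | ∀ z, objective f wm wp x' ≤ objective f wm wp z} x) {i : Fin (N + 1)}
    (hi : y i = false) : x i ≤ t := by
  have h1 : objective f wm wp (cut t y x) - objective f wm wp x ≤ 0 := by
    refine (h.objective_sub_le (x := x) (x' := cut t y x) fun j => ?_).trans ?_
    · have := hf j (x j)
      simp only [cut]
      split_ifs
      · simp
      · rcases le_total (x j) t with h | h
        · simp [h]
        · rw [min_eq_right h]; linarith
    · refine add_nonpos (Finset.sum_nonpos fun j _ => ?_) (Finset.sum_nonpos fun e _ => ?_)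
      · simp only [cut]
        split_ifs with hj
        · simp
        · exact mul_nonpos_of_nonneg_of_nonpos (h.residual_nonneg hw (by simpa using hj))
            (by simp)
      · refine sub_nonpos.2 (h.edge_le hw e ?_ ?_ ?_)
        · intro he
          simp only [cut, he]
          split_ifs
          · simp
          · grind
        · intro h1 h2
          simp [cut, h1, h2]
        · intro h1 h2
          have := min_le_left (x e.castSucc) t
          simp [cut, h1, h2]
          linarith
  have h2 := hx.2 (show cut t y x ∈ _ from fun z => by have := hx.1 z; linarith) i
  simp only [cut, hi] at h2
  exact (le_min_iff.1 h2).2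

theorem IsDP.le_of_label_true (h : IsDP G wm wp μ y) (hw : ∀ e, wm e ≤ wp e) {t : ℝ}
    (hf : ∀ i w, f i t + G i * (w - t) ≤ f i w) {x : Fin (N + 1) → ℝ}
    (hx : ∀ z, objective f wm wp x ≤ objective f wm wp z) {i : Fin (N + 1)}
    (hi : y i = true) : t ≤ x i := by
  have h1 := h.objective_sub_le (x := x) (x' := raise t y x) (f := f) fun j => by
    have := hf j (x j)
    simp only [raise]
    split_ifs
    · rcases le_total (x j) t with h | h
      · rw [max_eq_right h]; linarith
      · simp [h]
    · simp
  have hA : ∀ j ∈ Finset.univ, (G j + μ j - μ (j + 1)) * (raise t y x j - x j) ≤ 0 := fun j _ => by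
    simp only [raise]
    split_ifs with hj
    · exact mul_nonpos_of_nonpos_of_nonneg (h.residual_nonpos hw hj) (by simp)
    · simp
  have hB : ∀ e ∈ Finset.univ,
      pairTerm (wm e) (wp e) (raise t y x e.succ - raise t y x e.castSucc) -
        pairTerm (wm e) (wp e) (x e.succ - x e.castSucc) -
        μ (e + 1) * ((raise t y x e.succ - raise t y x e.castSucc) - (x e.succ - x e.castSucc)) ≤
      0 := fun e _ => by
    refine sub_nonpos.2 (h.edge_le hw e ?_ ?_ ?_)
    · intro he
      simp only [raise, he]
      split_ifs
      · grind
      · simp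
    · intro h1 h2
      have := le_max_left (x e.castSucc) t
      simp [raise, h1, h2]
      linarith
    · intro h1 h2
      simp [raise, h1, h2]
  have h2 := hx (raise t y x)
  have hA0 := (Finset.sum_eq_zero_iff_of_nonpos hA).1
    (le_antisymm (Finset.sum_nonpos hA) (by linarith [Finset.sum_nonpos hB]))
  have hB0 := (Finset.sum_eq_zero_iff_of_nonpos hB).1
    (le_antisymm (Finset.sum_nonpos hB) (by linarith [Finset.sum_nonpos hA]))
  clear h1 h2 hA hB hx
  induction i using Fin.reverseInduction with
  | last =>
    have h3 := hA0 (Fin.last N) (Finset.mem_univ _)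
    have h4 := hi
    rw [h.label_last, label_false_right] at h4
    simp only [Fin.val_last, h.last, raise, hi, if_true, sub_zero, mul_eq_zero] at h3
    rcases h3 with h3 | h3
    · linarith
    · exact max_eq_left_iff.1 (sub_eq_zero.1 h3)
  | cast e ih =>
    have h3 := hA0 e.castSucc (Finset.mem_univ _)
    have h4 := hB0 e (Finset.mem_univ _)
    have h5 := hi
    rw [h.label_step, label] at h5
    rw [Fin.val_castSucc] at h3
    by_contra hlt
    rw [not_le] at hlt
    split_ifs at h5 with h6 h7
    · rw [h.step, proj_of_lt h6] at h3
      simp only [raise, hi, if_true, mul_eq_zero, max_eq_right hlt.le] at h3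
      rcases h3 with h3 | h3 <;> linarith
    · have h8 := ih h5
      have h9 : μ (e + 1) = G e.castSucc + μ e := by
        rw [h.step, proj, if_neg h6, if_neg h7.not_gt]
      simp only [raise, hi, h5, if_true, max_eq_right hlt.le, max_eq_left h8, pairTerm] at h4
      rw [if_neg (by linarith), if_neg (by linarith)] at h4
      have h10 : (wp e - μ (e + 1)) * (t - x e.castSucc) = 0 := by linarith
      rcases mul_eq_zero.1 h10 with h10 | h10 <;> linarith

end Optimality

theorem exists_messages (z m : ℝ) (P : List Node) :
    ∃ μ : ℕ → ℝ, μ 0 = m ∧ ∀ i (hi : i < P.length),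
      μ (i + 1) = proj P[i].wm P[i].wp (P[i].g.eval z + μ i) ∧
      (labels z m P).getD i false = label (P[i].g.eval z + μ i) P[i].wm P[i].wp
        ((labels z m P).getD (i + 1) false) := by
  induction P generalizing m with
  | nil => exact ⟨fun _ => m, rfl, fun i hi => absurd hi (by simp)⟩
  | cons v P ih =>
    obtain ⟨μ, h0, h1⟩ := ih (proj v.wm v.wp (v.g.eval z + m))
    refine ⟨fun i => Nat.casesOn i m μ, rfl, fun i hi => ?_⟩
    cases i with
    | zero =>
      refine ⟨h0, ?_⟩
      simp only [labels, List.getD_cons_zero, List.getD_cons_succ, List.getElem_cons_zero]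
      cases labels z (proj v.wm v.wp (v.g.eval z + m)) P <;> rfl
    | succ i =>
      simpa [labels] using h1 i (by simpa using hi)

theorem exists_isDP_input {N : ℕ} (g : Fin (N + 1) → StepFn) (wm wp : Fin N → ℝ) (z : ℝ) :
    ∃ μ, IsDP (fun i => (g i).eval z) wm wp μ
      fun i => (labels z 0 (input g wm wp)).getD i false := by
  obtain ⟨μ, h0, h1⟩ := exists_messages z 0 (input g wm wp)
  have hlen : (input g wm wp).length = N + 1 := by simp [input]
  have hlast := h1 N (by omega)
  have hd : (labels z 0 (input g wm wp)).getD (N + 1) false = false :=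
    List.getD_eq_default _ _ (by rw [labels_length, hlen])
  have eN : (⟨N, by omega⟩ : Fin (N + 1)) = Fin.last N := rfl
  simp only [input, List.getElem_ofFn, eN, Fin.snoc_last] at hlast
  refine ⟨μ, h0, ?_, fun e => ?_, ?_, fun e => ?_⟩
  · rw [hlast.1, proj]
    split_ifs <;> linarith
  · have := (h1 e (by have := e.2; omega)).1
    have ee : (⟨e, by omega⟩ : Fin (N + 1)) = e.castSucc := rfl
    simpa only [input, List.getElem_ofFn, ee, Fin.snoc_castSucc] using this
  · exact hlast.2.trans (congrArg _ hd)
  · have := (h1 e (by have := e.2; omega)).2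
    have ee : (⟨e, by omega⟩ : Fin (N + 1)) = e.castSucc := rfl
    simpa only [input, List.getElem_ofFn, ee, Fin.snoc_castSucc, Fin.val_castSucc, Fin.val_succ] using this

theorem mem_input {N : ℕ} {g : Fin (N + 1) → StepFn} {wm wp : Fin N → ℝ} {v : Node}
    (hv : v ∈ input g wm wp) : ∃ i, v.g = g i := by
  obtain ⟨i, rfl⟩ := List.mem_ofFn.1 hv
  exact ⟨i, rfl⟩

theorem input_weights {N : ℕ} {g : Fin (N + 1) → StepFn} {wm wp : Fin N → ℝ}
    (hw : ∀ e, wm e ≤ wp e) : ∀ v ∈ input g wm wp, v.wm ≤ v.wp := by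
  intro v hv
  obtain ⟨i, rfl⟩ := List.mem_ofFn.1 hv
  induction i using Fin.lastCases with
  | last => simp
  | cast e => simpa using hw e

/-- Slightly below `t` a left-continuous step function takes the same value as at `t`. -/
theorem exists_lt_eval_eq (L : List ℝ) (t : ℝ) :
    ∃ s < t, ∀ b ∈ L, (b < s ↔ b < t) := by
  induction L with
  | nil => exact ⟨t - 1, by linarith, by simp⟩
  | cons b L ih =>
    obtain ⟨s, hs, h⟩ := ih
    by_cases hb : b < t
    · obtain ⟨r, hr, hrt⟩ := exists_between (max_lt hs hb)
      refine ⟨r, hrt, List.forall_mem_cons.2 ⟨?_, fun c hc => ?_⟩⟩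
      · exact iff_of_true ((le_max_right _ _).trans_lt hr) hb
      · exact ⟨fun h => h.trans hrt,
          fun h' => (((h c hc).2 h').trans_le (le_max_left _ _)).trans hr⟩
    · exact ⟨s, hs, List.forall_mem_cons.2 ⟨iff_of_false (fun h => hb (h.trans hs)) hb, h⟩⟩

theorem labels_input {N : ℕ} {f : Fin (N + 1) → ℝ → ℝ} {g : Fin (N + 1) → StepFn}
    {wm wp : Fin N → ℝ} (hf : ∀ i, ConvexOn ℝ Set.univ (f i)) (hg : ∀ i, (g i).IsLeftDerivOf (f i))
    (hw : ∀ e, wm e ≤ wp e) {x : Fin (N + 1) → ℝ}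
    (hx : IsLeast {x' | ∀ z, objective f wm wp x' ≤ objective f wm wp z} x) (t : ℝ) :
    labels t 0 (input g wm wp) =
      (List.ofFn fun i => ((x i : ℝ) : WithBot ℝ)).map (atLeast t) := by
  have hsub : ∀ s i w, f i s + (g i).eval s * (w - s) ≤ f i w := fun s i w =>
    (hf i).add_mul_le_of_hasDerivWithinAt_Iic (hg i s) w
  have hlen : (labels t 0 (input g wm wp)).length = N + 1 := by
    simp [labels_length, input]
  refine List.ext_getElem (by simp [hlen]) fun i hi _ => ?_
  have hi' : i < N + 1 := by omega
  rw [List.getElem_map, List.getElem_ofFn, ← List.getD_eq_getElem _ false hi]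
  rcases hy : (labels t 0 (input g wm wp)).getD i false with _ | _
  · obtain ⟨s, hs, hb⟩ := exists_lt_eval_eq (bpList (input g wm wp)) t
    have e : labels s 0 (input g wm wp) = labels t 0 (input g wm wp) :=
      labels_congr 0 fun v hv => eval_eq_of_forall fun p hp =>
        hb _ (List.mem_flatMap.2 ⟨v, hv, List.mem_map.2 ⟨p, hp, rfl⟩⟩)
    obtain ⟨μ, hμ⟩ := exists_isDP_input g wm wp s
    rw [e] at hμ
    have := hμ.le_of_label_false hw (hsub s) hx (i := ⟨i, hi'⟩) hy
    exact (atLeast_eq_false.2 (WithBot.coe_lt_coe.2 (this.trans_lt hs))).symm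
  · obtain ⟨μ, hμ⟩ := exists_isDP_input g wm wp t
    have := hμ.le_of_label_true hw (hsub t) hx.1 (i := ⟨i, hi'⟩) hy
    exact (atLeast_eq_true.2 (WithBot.coe_le_coe.2 this)).symm

theorem minimize_val {N : ℕ} {f : Fin (N + 1) → ℝ → ℝ} {g : Fin (N + 1) → StepFn}
    {wm wp : Fin N → ℝ} (hf : ∀ i, ConvexOn ℝ Set.univ (f i)) (hg : ∀ i, (g i).IsLeftDerivOf (f i))
    (hw : ∀ e, wm e ≤ wp e) {x : Fin (N + 1) → ℝ}
    (hx : IsLeast {x' | ∀ z, objective f wm wp x' ≤ objective f wm wp z} x) :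
    (minimize (input g wm wp)).val = List.ofFn fun i => ((x i : ℝ) : WithBot ℝ) := by
  obtain ⟨b, hb⟩ := (((bpList (input g wm wp)).finite_toSet).union
    (Set.finite_range x)).bddAbove
  have hb1 : ∀ r ∈ bpList (input g wm wp), r < b + 1 := fun r hr =>
    (hb (Or.inl hr)).trans_lt (lt_add_one b)
  have hb2 : ∀ i, x i < b + 1 := fun i => (hb (Or.inr ⟨i, rfl⟩)).trans_lt (lt_add_one b)
  simp only [minimize, val_bind, breakpoints_val, length_val, val_add]
  refine solve_val _ ⊥ (b + 1) (WithBot.bot_lt_coe _) _ _ (Nat.lt_succ_self _)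
    ⟨fun r hr => ⟨WithBot.bot_lt_coe _, hb1 r hr⟩, input_weights hw, fun v hv => ?_, fun w hw => ?_,
      fun t _ => labels_input hf hg hw hx t⟩
  · obtain ⟨i, hi⟩ := mem_input hv
    rw [hi]
    exact ((hg i).monotone (hf i)).monotoneOn _
  · obtain ⟨i, rfl⟩ := List.mem_ofFn.1 hw
    exact ⟨bot_le, WithBot.coe_lt_coe.2 (hb2 i)⟩

theorem bpList_length_le {K : ℕ} {P : List Node} (h : ∀ v ∈ P, v.g.bps.length ≤ K) :
    (bpList P).length ≤ K * P.length := by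
  induction P with
  | nil => simp
  | cons v P ih =>
    rw [List.forall_mem_cons] at h
    have := ih h.2
    simp only [bpList_cons, List.length_append, List.length_map, List.length_cons, mul_add]
    omega

theorem size_mul_le (K n : ℕ) : (K * n).size ≤ K + n.size := by
  rw [Nat.size_le, pow_add]
  exact Nat.mul_lt_mul'' Nat.lt_two_pow_self (Nat.lt_size_self n)

theorem size_mul_log_two_le {n : ℕ} (hn : 1 ≤ n) : (n.size : ℝ) * Real.log 2 ≤
    Real.log n + Real.log 2 := by
  have h0 : n.size ≠ 0 := by rw [Ne, Nat.size_eq_zero]; omega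
  obtain ⟨s, hs⟩ := Nat.exists_eq_succ_of_ne_zero h0
  have h1 : 2 ^ s ≤ n := Nat.lt_size.1 (by omega)
  have h2 : Real.log ((2 : ℝ) ^ s) ≤ Real.log n :=
    Real.log_le_log (by positivity) (by exact_mod_cast h1)
  rw [Real.log_pow] at h2
  rw [hs]
  push_cast
  linarith

theorem minimize_cost_le_mul_log {K n : ℕ} (hn : 2 ≤ n) {P : List Node} (hP : P.length = n)
    (h : ∀ v ∈ P, v.g.bps.length ≤ K) :
    ((minimize P).cost : ℝ) ≤
      2010 * (K + 1) * ((K + 3) / Real.log 2) * ((n : ℝ) * Real.log n) := by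
  have h1 := minimize_cost_le P (List.length_pos_iff.1 (by omega))
  have h2 := bpList_length_le h
  rw [hP] at h1 h2
  have h3 : (minimize P).cost ≤ 2010 * (n + K * n) * (K + n.size + 1) := by
    refine h1.trans ?_
    gcongr
    exact (Nat.size_le_size h2).trans (size_mul_le K n)
  have hl2 : 0 < Real.log 2 := Real.log_pos one_lt_two
  have hln : Real.log 2 ≤ Real.log n := Real.log_le_log two_pos (by exact_mod_cast hn)
  have h4 : ((K : ℝ) + n.size + 1) ≤ (K + 3) / Real.log 2 * Real.log n := by
    rw [div_mul_eq_mul_div, le_div_iff₀ hl2]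
    have h5 := size_mul_log_two_le (n := n) (by omega)
    have h6 : ((K : ℝ) + 2) * Real.log 2 ≤ (K + 2) * Real.log n := by gcongr
    linarith
  calc ((minimize P).cost : ℝ) ≤ ((2010 * (n + K * n) * (K + n.size + 1) : ℕ) : ℝ) := by
        exact_mod_cast h3
    _ = 2010 * (n + K * n) * (K + n.size + 1) := by push_cast; ring
    _ ≤ 2010 * (n + K * n) * ((K + 3) / Real.log 2 * Real.log n) := by gcongr
    _ = _ := by ring

end ChainTV

theorem mainTheorem6 (K : ℕ) :
    ∃ C : ℝ, ∀ (N : ℕ) (f : Fin (N + 1) → ℝ → ℝ) (g : Fin (N + 1) → ChainTV.StepFn)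
      (wm wp : Fin N → ℝ),
      (∀ i, ConvexOn ℝ Set.univ (f i)) →
      (∀ i, (g i).IsLeftDerivOf (f i)) →
      (∀ i, (g i).bps.length ≤ K) →
      (∀ e, wm e ≤ wp e) →
      -- the running time is `O(n log n)` for chains with `n = N + 1` nodes
      (2 ≤ N + 1 →
        ((ChainTV.minimize (ChainTV.input g wm wp)).cost : ℝ) ≤
          C * (((N + 1 : ℕ) : ℝ) * Real.log ((N + 1 : ℕ) : ℝ))) ∧
      -- the output is the lowest minimizer, if it is finite
      (∀ x : Fin (N + 1) → ℝ,
        IsLeast {x' | ∀ z, ChainTV.objective f wm wp x' ≤ ChainTV.objective f wm wp z} x →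
        (ChainTV.minimize (ChainTV.input g wm wp)).val =
          List.ofFn fun i => ((x i : ℝ) : WithBot ℝ)) := by
  refine ⟨2010 * (K + 1) * ((K + 3) / Real.log 2), fun N f g wm wp hf hg hK hw =>
    ⟨fun hn => ?_, fun x hx => ChainTV.minimize_val hf hg hw hx⟩⟩
  refine ChainTV.minimize_cost_le_mul_log hn (by simp [ChainTV.input]) fun v hv => ?_
  obtain ⟨i, hi⟩ := ChainTV.mem_input hv
  rw [hi]
  exact hK i
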